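/- **Setting.** Let $\mathcal L$ be a finite set, $\mu,\nu$ probability vectors on $\mathcal L$, and $a,b\ge 0$ constants. For $n\in\mathbb N$ the labeled stochastic block model $\mathcal G(n,a/n,b/n,\mu,\nu)$ (for $n\ge\max(a,b)$) generates $(G,L,\sigma)$ as follows: the types $\sigma_u\in\{\pm1\}$, $u\in[n]$, are independent and uniform; given $\sigma$, independently for every pair $u<v$, there is an edge $uv$ with probability $a/n$ if $\sigma_u=\sigma_v$ and with probability $b/n$ otherwise, and an edge $uv$ gets the label $L_{uv}=\ell$ with probability $\mu(\ell)$ if $\sigma_u=\sigma_v$ and $\nu(\ell)$ otherwise. For a weight function $w:\mathcal L\to[-1,1]$ (not depending on $n$) let $W$ be the symmetric matrix with $W_{uv}=w(L_{uv})$ if $uv$ is an edge and $W_{uv}=0$ otherwise. Let $\widehat Y$ be a maximizer of $\langle W,Y\rangle=\sum_{u,v}W_{uv}Y_{uv}$ over all real symmetric $n\times n$ matrices $Y$ with $Y\succeq0$, $Y_{uu}=1$ for all $u$, and $\sum_{u,v}Y_{uv}=0$; let $y$ be an eigenvector of $\widehat Y$ for its largest eigenvalue with Euclidean norm $\|y\|=\sqrt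 n$, and let $\widehat\sigma=\mathrm{sign}(y)$ componentwise, with $\mathrm{sign}(0)=0$. With $d$ the Hamming distance, the overlap is $$Q(\sigma,\widehat\sigma)=\tfrac12-\tfrac1n\min\{d(\sigma,\widehat\sigma),d(\sigma,-\widehat\sigma)\}.$$ Use the convention $0/0=0$ and put $$\tau=\frac{a+b}{2}\sum_{\ell}\frac{a\mu(\ell)+b\nu(\ell)}{a+b}\left(\frac{a\mu(\ell)-b\nu(\ell)}{a\mu(\ell)+b\nu(\ell)}\right)^2,\qquad R(w)=\frac{\sum_\ell(a\mu(\ell)-b\nu(\ell))\,w(\ell)}{\sqrt{\sum_\ell(a\mu(\ell)+b\nu(\ell))\,w(\ell)^2}}.$$ **Theorem.** (i) Let $w:\mathcal L\to[-1,1]$ satisfy $\sum_\ell w(\ell)^2(a\mu(\ell)+b\nu(\ell))>8\ln2$ and $R(w)>512\sqrt{\ln 2}$. Then $\widehat\sigma$ is positively correlated with $\sigma$: there is a constant $\delta>0$ (independent of $n$) such that the probability that $Q(\sigma,\widehat\sigma)\ge\delta$ for every choice of the maximizer $\widehat Y$ and of the top eigenvector $y$ tends to $1$ as $n\to\infty$;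 in particular $Q(\sigma,\widehat\sigma)>0$ asymptotically almost surely. (ii) The weight $w^*(\ell)=\frac{a\mu(\ell)-b\nu(\ell)}{a\mu(\ell)+b\nu(\ell)}$ takes values in $[-1,1]$ and maximizes $R$: $R(w)\le R(w^*)$ for all $w:\mathcal L\to\mathbb R$. Moreover $R(w^*)>512\sqrt{\ln2}$ if and only if $\tau>2^{17}\ln2$. -/

import Mathlib

namespace LabeledSBM

noncomputable section

/-- Unordered pairs of distinct vertices of `[n]`, written in increasing order. -/
abbrev VertexPair (n : ℕ) : Type := {e : Fin n × Fin n // e.1 < e.2}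

/-- An edge-labeled simple graph `(G, L)` on `[n]`: for every pair `u < v` the value is `none` if
`uv` is not an edge, and `some ℓ` if `uv` is an edge with label `ℓ`. -/
abbrev LabeledGraph (n : ℕ) (𝓛 : Type*) : Type _ := VertexPair n → Option 𝓛

/-- A realization `(G, L, σ)` of the model: a labeled graph and a type `±1` for every vertex. -/
abbrev Realization (n : ℕ) (𝓛 : Type*) : Type _ := LabeledGraph n 𝓛 × (Fin n → ℤˣ)

/-- The factor `φ_{uv}(G, L, σ)` of a vertex pair, as a function of its state and of whether the
types of its two endpoints agree. -/
def pairFactor {𝓛 : Type*} (p q : ℝ) (μ ν : 𝓛 → ℝ) (s t : ℤˣ) : Option 𝓛 → ℝ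
  | some ℓ => if s = t then p * μ ℓ else q * ν ℓ
  | none => if s = t then 1 - p else 1 - q

/-- The probability of a realization `(G, L, σ)` under `𝒢(n, p, q, μ, ν)`:
`2⁻ⁿ ∏_{u < v} φ_{uv}(G, L, σ)`. -/
def realizationProb {𝓛 : Type*} {n : ℕ} (p q : ℝ) (μ ν : 𝓛 → ℝ) (x : Realization n 𝓛) : ℝ :=
  ((2 : ℝ) ^ n)⁻¹ * ∏ e : VertexPair n, pairFactor p q μ ν (x.2 e.1.1) (x.2 e.1.2) (x.1 e)

open Classical in
/-- The probability of an event under `𝒢(n, p, q, μ, ν)`. (For `p, q ∈ [0, 1]` and probability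
vectors `μ, ν` this is a probability measure on the finite set of realizations.) -/
def prob {𝓛 : Type*} [Fintype 𝓛] {n : ℕ} (p q : ℝ) (μ ν : 𝓛 → ℝ)
    (E : Set (Realization n 𝓛)) : ℝ :=
  ∑ x : Realization n 𝓛, if x ∈ E then realizationProb p q μ ν x else 0

/-- The contribution of a vertex pair to the weighted adjacency matrix: `w ℓ` for an edge with
label `ℓ`, and `0` for a non-edge. -/
def edgeWeight {𝓛 : Type*} (w : 𝓛 → ℝ) : Option 𝓛 → ℝ
  | some ℓ => w ℓ
  | none => 0

/-- The weighted adjacency matrix `W_{uv} = A_{uv} w(L_{uv})` (symmetric, zero diagonal). -/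
def weightMatrix {𝓛 : Type*} {n : ℕ} (w : 𝓛 → ℝ) (G : LabeledGraph n 𝓛) :
    Matrix (Fin n) (Fin n) ℝ := fun u v =>
  if h : u < v then edgeWeight w (G ⟨(u, v), h⟩)
  else if h : v < u then edgeWeight w (G ⟨(v, u), h⟩)
  else 0

/-- The feasible set of the semidefinite program: `Y ⪰ 0`, `Y_{uu} = 1`, `⟨J, Y⟩ = 0`. -/
def sdpFeasible (n : ℕ) : Set (Matrix (Fin n) (Fin n) ℝ) :=
  {Y | Y.PosSemidef ∧ (∀ u, Y u u = 1) ∧ ∑ u, ∑ v, Y u v = 0}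

/-- `Y` solves the semidefinite program: maximize `⟨W, Y⟩` over the feasible set. -/
def IsSDPSolution {n : ℕ} (W Y : Matrix (Fin n) (Fin n) ℝ) : Prop :=
  Y ∈ sdpFeasible n ∧ IsMaxOn (fun Z => ∑ u, ∑ v, W u v * Z u v) (sdpFeasible n) Y

/-- `y` is an eigenvector of `Y` for the largest eigenvalue of `Y`, with Euclidean norm `√n`. -/
def IsTopEigenvector {n : ℕ} (Y : Matrix (Fin n) (Fin n) ℝ) (y : Fin n → ℝ) : Prop :=
  (∃ κ : ℝ, IsGreatest {κ' : ℝ | Module.End.HasEigenvalue (Matrix.toLin' Y) κ'} κ ∧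
    Module.End.HasEigenvector (Matrix.toLin' Y) κ y) ∧
  ‖WithLp.toLp 2 y‖ = √(n : ℝ)

/-- A type assignment `σ ∈ {±1}ⁿ` as a real vector. -/
def typeVec {n : ℕ} (σ : Fin n → ℤˣ) : Fin n → ℝ := fun u => ((σ u : ℤ) : ℝ)

open Classical in
/-- The overlap `Q(x, x̂) = 1/2 - (1/n) min {d(x, x̂), d(x, -x̂)}`, `d` the Hamming distance. -/
def overlap {n : ℕ} (x xhat : Fin n → ℝ) : ℝ :=
  1 / 2 - 1 / (n : ℝ) * min (hammingDist x xhat : ℝ) (hammingDist x (-xhat) : ℝ)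

/-- The estimate `sign(y)`, where `y` is a top eigenvector of a solution of the semidefinite
program, is positively correlated with the true types when `(G, L, σ) ∼ 𝒢(n, a/n, b/n, μ, ν)`:
the overlap is asymptotically almost surely bounded below by a positive constant `δ` that does not
depend on `n`; in particular it is asymptotically almost surely positive. The event asks this
for every solution `Y` and every top eigenvector `y`. Here `Real.sign 0 = 0`, so a vertex
with `y u = 0` counts as an error both for `sign(y)` and for `-sign(y)`, and breaking such ties
in any other way can only increase the overlap. -/
def SDPPositivelyCorrelated {𝓛 : Type*} [Fintype 𝓛] (a b : ℝ) (μ ν w : 𝓛 → ℝ) : Prop :=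
  ∃ δ : ℝ, 0 < δ ∧
    Filter.Tendsto
      (fun n : ℕ => prob (a / n) (b / n) μ ν
        {x : Realization n 𝓛 | ∀ (Y : Matrix (Fin n) (Fin n) ℝ) (y : Fin n → ℝ),
          IsSDPSolution (weightMatrix w x.1) Y → IsTopEigenvector Y y →
            δ ≤ overlap (typeVec x.2) (fun u => Real.sign (y u))})
      Filter.atTop (nhds 1)

/-- `∑_ℓ (a μ(ℓ) + b ν(ℓ)) w(ℓ)²`. -/
def secondMoment {𝓛 : Type*} [Fintype 𝓛] (a b : ℝ) (μ ν w : 𝓛 → ℝ) : ℝ :=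
  ∑ ℓ, (a * μ ℓ + b * ν ℓ) * w ℓ ^ 2

/-- The normalized weighted gap
`∑_ℓ (a μ(ℓ) - b ν(ℓ)) w(ℓ) / √(∑_ℓ (a μ(ℓ) + b ν(ℓ)) w(ℓ)²)`. -/
def normalizedGap {𝓛 : Type*} [Fintype 𝓛] (a b : ℝ) (μ ν w : 𝓛 → ℝ) : ℝ :=
  (∑ ℓ, (a * μ ℓ - b * ν ℓ) * w ℓ) / √(secondMoment a b μ ν w)

/-- The weight function `(a μ(ℓ) - b ν(ℓ)) / (a μ(ℓ) + b ν(ℓ))`. -/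
def optWeight {𝓛 : Type*} (a b : ℝ) (μ ν : 𝓛 → ℝ) : 𝓛 → ℝ := fun ℓ =>
  (a * μ ℓ - b * ν ℓ) / (a * μ ℓ + b * ν ℓ)

/-- The parameter `τ`. -/
def tau {𝓛 : Type*} [Fintype 𝓛] (a b : ℝ) (μ ν : 𝓛 → ℝ) : ℝ :=
  (a + b) / 2 * ∑ ℓ, (a * μ ℓ + b * ν ℓ) / (a + b) *
    ((a * μ ℓ - b * ν ℓ) / (a * μ ℓ + b * ν ℓ)) ^ 2

end

end LabeledSBM

/-! Given the types, `W` is its conditional mean plus independent centred noise. Write α = Σ aμw, β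
= Σ bνw and s = Σ (aμ + bν)w². On the feasible set ⟨J, Y⟩ = 0 removes the uninformative part of the
mean, so the mean pairs with `Y` as ((α - β)/2n) σᵀYσ plus a constant (`sum_meanMatrix_mul`), and α
- β = R(w)√s. The noise has cut norm at most 5√(s ln 2)·n except with conditional probability 2⁻ⁿ,
by a Chernoff bound and a union over 4ⁿ pairs of sign vectors (`condProb_cutNorm_gt_le`).
Grothendieck's inequality (`gramForm_le_of_forall_abs_le_one`) turns this into a bound uniform over
all feasible `Y`, so the dependence of the maximizer on the noise is harmless. Comparing the
maximizer with a feasible matrix close to σσᵀ (`exists_feasible_quadForm_ge`) gives σᵀYσ ≥ 3n²/4. As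
`Y` has trace n, its top eigenvector must then align with σ (`sum_mul_sq_ge_of_quadForm_ge`), and
rounding errs on at most 2n/5 vertices up to a global sign. The types are nearly balanced by
Chebyshev. Optimality of w* is Cauchy–Schwarz with weights aμ + bν, and R(w*)² = 2τ. -/

namespace LabeledSBM

/-! ### Rademacher averages and truncation. -/

/-- The average of `F` over uniform signs. -/
noncomputable def signAvg {m : ℕ} (F : (Fin m → ℤˣ) → ℝ) : ℝ := ((2 : ℝ) ^ m)⁻¹ * ∑ ε, F ε

/-- The Rademacher sum `∑ₖ εₖ uₖ`. -/
def signSum {m : ℕ} (u : Fin m → ℝ) (ε : Fin m → ℤˣ) : ℝ := ∑ k, ((ε k : ℤ) : ℝ) * u k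

theorem signAvg_succ {m : ℕ} (F : (Fin (m + 1) → ℤˣ) → ℝ) :
    signAvg F = signAvg fun ε => (F (Fin.cons 1 ε) + F (Fin.cons (-1) ε)) / 2 := by
  have h : ∑ ε, F ε = ∑ p : ℤˣ × (Fin m → ℤˣ), F (Fin.cons p.1 p.2) :=
    (Fintype.sum_equiv (Fin.consEquiv fun _ => ℤˣ) _ _ fun _ => rfl).symm
  have h2 : ∀ f : ℤˣ → ℝ, ∑ s, f s = f 1 + f (-1) := fun f => by
    rw [show (Finset.univ : Finset ℤˣ) = {1, -1} from rfl, Finset.sum_pair (by decide)]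
  unfold signAvg
  rw [h, Fintype.sum_prod_type, h2, ← Finset.sum_div, Finset.sum_add_distrib, pow_succ]
  field_simp

theorem signSum_cons {m : ℕ} (u : Fin (m + 1) → ℝ) (s : ℤˣ) (ε : Fin m → ℤˣ) :
    signSum u (Fin.cons s ε) = ((s : ℤ) : ℝ) * u 0 + signSum (fun k => u k.succ) ε := by
  simp [signSum, Fin.sum_univ_succ]

theorem signAvg_add {m : ℕ} (F H : (Fin m → ℤˣ) → ℝ) :
    signAvg (fun ε => F ε + H ε) = signAvg F + signAvg H := by
  simp [signAvg, Finset.sum_add_distrib, mul_add]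

theorem signAvg_mul_left {m : ℕ} (c : ℝ) (F : (Fin m → ℤˣ) → ℝ) :
    signAvg (fun ε => c * F ε) = c * signAvg F := by
  simp only [signAvg, ← Finset.mul_sum]; ring

theorem signAvg_const {m : ℕ} (c : ℝ) : signAvg (fun _ : Fin m → ℤˣ => c) = c := by
  simp [signAvg]

theorem signAvg_mono {m : ℕ} {F H : (Fin m → ℤˣ) → ℝ} (h : ∀ ε, F ε ≤ H ε) :
    signAvg F ≤ signAvg H := by
  unfold signAvg
  exact mul_le_mul_of_nonneg_left (Finset.sum_le_sum fun ε _ => h ε) (by positivity)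

theorem signAvg_signSum_mul {m : ℕ} (u v : Fin m → ℝ) :
    signAvg (fun ε => signSum u ε * signSum v ε) = ∑ k, u k * v k := by
  induction m with
  | zero => simp [signAvg, signSum]
  | succ m ih =>
    rw [signAvg_succ, Fin.sum_univ_succ, ← ih, ← signAvg_const (m := m) (u 0 * v 0),
      ← signAvg_add]
    congr 1; funext ε
    simp only [signSum_cons]
    push_cast
    ring

theorem signAvg_signSum_sq {m : ℕ} (u : Fin m → ℝ) :
    signAvg (fun ε => signSum u ε ^ 2) = ∑ k, u k ^ 2 := by
  simpa only [sq] using signAvg_signSum_mul u u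

/-- Khintchine's inequality for the fourth moment: averaging over one sign kills the odd powers of
its coordinate, which leaves an induction on the dimension. -/
theorem signAvg_signSum_pow_four_le {m : ℕ} (u : Fin m → ℝ) :
    signAvg (fun ε => signSum u ε ^ 4) ≤ 3 * (∑ k, u k ^ 2) ^ 2 := by
  induction m with
  | zero => simp [signAvg, signSum]
  | succ m ih =>
    have h := ih fun k => u k.succ
    have h2 := signAvg_signSum_sq fun k => u k.succ
    rw [signAvg_succ, Fin.sum_univ_succ]
    have e : (fun ε : Fin m → ℤˣ => (signSum u (Fin.cons 1 ε) ^ 4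
        + signSum u (Fin.cons (-1) ε) ^ 4) / 2) = fun ε =>
        signSum (fun k => u k.succ) ε ^ 4 + ((6 * u 0 ^ 2) * signSum (fun k => u k.succ) ε ^ 2
          + u 0 ^ 4) := by
      funext ε
      simp only [signSum_cons]
      push_cast
      ring
    rw [e, signAvg_add, signAvg_add, signAvg_mul_left, h2, signAvg_const]
    nlinarith [sq_nonneg (u 0 ^ 2)]

/-- Truncation of a real number to `[-4/3, 4/3]`. -/
noncomputable def clip (x : ℝ) : ℝ := max (-(4 / 3)) (min (4 / 3) x)

theorem abs_clip_le (x : ℝ) : |clip x| ≤ 4 / 3 :=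
  abs_le.2 ⟨le_max_left _ _, max_le (by norm_num) (min_le_left _ _)⟩

theorem clip_sq_le (x : ℝ) : clip x ^ 2 ≤ x ^ 2 := by
  unfold clip
  rcases le_total (4 / 3) x with h | h
  · rw [min_eq_left h, max_eq_right (by norm_num)]; nlinarith
  · rw [min_eq_right h]
    rcases le_total (-(4 / 3)) x with h' | h'
    · rw [max_eq_right h']
    · rw [max_eq_left h']; nlinarith

/-- For y ≥ 4/3 the ratio (y - 4/3)/y² peaks at y = 8/3 with value 3/16, and (3/16)² < 1/27. With
the fourth moment bound 3, the truncation error of a Rademacher sum of a unit vector has second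
moment at most 1/9. -/
theorem sub_clip_sq_le (x : ℝ) : (x - clip x) ^ 2 ≤ x ^ 4 / 27 := by
  unfold clip
  have key : ∀ y : ℝ, 4 / 3 ≤ y → (y - 4 / 3) ^ 2 ≤ y ^ 4 / 27 := by
    intro y hy
    have h1 : 0 ≤ 16 / 3 * (y - 4 / 3) := by linarith
    have h2 : 16 / 3 * (y - 4 / 3) ≤ y ^ 2 := by nlinarith [sq_nonneg (y - 8 / 3)]
    nlinarith [pow_le_pow_left₀ h1 h2 2, sq_nonneg (y - 4 / 3)]
  rcases le_total (4 / 3) x with h | h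
  · rw [min_eq_left h, max_eq_right (by norm_num)]; exact key x h
  · rw [min_eq_right h]
    rcases le_total (-(4 / 3)) x with h' | h'
    · rw [max_eq_right h', sub_self]
      have : 0 ≤ x ^ 4 := by positivity
      linarith
    · rw [max_eq_left h']
      have := key (-x) (by linarith)
      calc (x - -(4 / 3)) ^ 2 = (-x - 4 / 3) ^ 2 := by ring
        _ ≤ _ := this
        _ = _ := by ring

/-! ### Grothendieck's inequality. -/

/-- The bilinear form `∑ᵢⱼ Mᵢⱼ ⟨uᵢ, vⱼ⟩`. -/
def gramForm {α β κ : Type*} [Fintype α] [Fintype β] [Fintype κ] (M : α → β → ℝ)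
    (u : α → κ → ℝ) (v : β → κ → ℝ) : ℝ := ∑ i, ∑ j, M i j * ∑ k, u i k * v j k

section gramForm
variable {α β κ : Type*} [Fintype α] [Fintype β] [Fintype κ] (M : α → β → ℝ)

theorem gramForm_eq_sum (u : α → κ → ℝ) (v : β → κ → ℝ) :
    gramForm M u v = ∑ k, ∑ i, ∑ j, M i j * u i k * v j k := by
  simp only [gramForm, Finset.mul_sum, mul_assoc]
  rw [Finset.sum_comm]
  conv_lhs => enter [2, j]; rw [Finset.sum_comm]
  rw [Finset.sum_comm]
  exact Finset.sum_congr rfl fun k _ => Finset.sum_comm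

theorem gramForm_le_sum_abs (u : α → κ → ℝ) (v : β → κ → ℝ) (hu : ∀ i, ∑ k, u i k ^ 2 ≤ 1)
    (hv : ∀ j, ∑ k, v j k ^ 2 ≤ 1) : gramForm M u v ≤ ∑ i, ∑ j, |M i j| := by
  refine Finset.sum_le_sum fun i _ => Finset.sum_le_sum fun j _ => ?_
  have h1 : |∑ k, u i k * v j k| ≤ 1 := by
    refine abs_le_one_iff_mul_self_le_one.2 ?_
    have := Finset.sum_mul_sq_le_sq_mul_sq Finset.univ (u i) (v j)
    nlinarith [hu i, hv j, Finset.sum_nonneg (fun k (_ : k ∈ Finset.univ) => sq_nonneg (u i k)),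
      Finset.sum_nonneg (fun k (_ : k ∈ Finset.univ) => sq_nonneg (v j k))]
  calc M i j * ∑ k, u i k * v j k ≤ |M i j * ∑ k, u i k * v j k| := le_abs_self _
    _ = |M i j| * |∑ k, u i k * v j k| := abs_mul _ _
    _ ≤ |M i j| * 1 := by gcongr
    _ = _ := mul_one _

theorem gramForm_comp_equiv {κ' : Type*} [Fintype κ'] (e : κ' ≃ κ) (u : α → κ → ℝ)
    (v : β → κ → ℝ) :
    gramForm M (fun i k => u i (e k)) (fun j k => v j (e k)) = gramForm M u v := by
  unfold gramForm
  refine Finset.sum_congr rfl fun i _ => Finset.sum_congr rfl fun j _ => ?_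
  rw [Equiv.sum_comp e fun k => u i k * v j k]

theorem gramForm_smul (c d : ℝ) (u : α → κ → ℝ) (v : β → κ → ℝ) :
    gramForm M (fun i k => c * u i k) (fun j k => d * v j k) = c * d * gramForm M u v := by
  simp only [gramForm_eq_sum, Finset.mul_sum]
  refine Finset.sum_congr rfl fun k _ => Finset.sum_congr rfl fun i _ =>
    Finset.sum_congr rfl fun j _ => by ring

theorem exists_fin_gramForm_eq (u : α → κ → ℝ) (v : β → κ → ℝ) (hu : ∀ i, ∑ k, u i k ^ 2 ≤ 1)
    (hv : ∀ j, ∑ k, v j k ^ 2 ≤ 1) :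
    ∃ (m : ℕ) (u' : α → Fin m → ℝ) (v' : β → Fin m → ℝ), (∀ i, ∑ k, u' i k ^ 2 ≤ 1) ∧
      (∀ j, ∑ k, v' j k ^ 2 ≤ 1) ∧ gramForm M u v = gramForm M u' v' := by
  let e := (Fintype.equivFin κ).symm
  refine ⟨_, fun i k => u i (e k), fun j k => v j (e k), fun i => ?_, fun j => ?_,
    (gramForm_comp_equiv M e u v).symm⟩
  · rw [Equiv.sum_comp e fun k => u i k ^ 2]; exact hu i
  · rw [Equiv.sum_comp e fun k => v j k ^ 2]; exact hv j

/-- **Grothendieck's inequality** with constant `16/3`. -/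
theorem gramForm_le_of_forall_abs_le_one {B : ℝ}
    (hB : ∀ x : α → ℝ, ∀ z : β → ℝ, (∀ i, |x i| ≤ 1) → (∀ j, |z j| ≤ 1) →
      ∑ i, ∑ j, M i j * x i * z j ≤ B)
    (u : α → κ → ℝ) (v : β → κ → ℝ) (hu : ∀ i, ∑ k, u i k ^ 2 ≤ 1)
    (hv : ∀ j, ∑ k, v j k ^ 2 ≤ 1) : gramForm M u v ≤ 16 / 3 * B := by
  let S : Set ℝ := {r | ∃ (m : ℕ) (u : α → Fin m → ℝ) (v : β → Fin m → ℝ),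
    (∀ i, ∑ k, u i k ^ 2 ≤ 1) ∧ (∀ j, ∑ k, v j k ^ 2 ≤ 1) ∧ r = gramForm M u v}
  have hS : BddAbove S := by
    refine ⟨∑ i, ∑ j, |M i j|, ?_⟩
    rintro _ ⟨m, u, v, hu, hv, rfl⟩
    exact gramForm_le_sum_abs M u v hu hv
  have hne : S.Nonempty := ⟨_, 0, fun _ _ => 0, fun _ _ => 0, by simp, by simp, rfl⟩
  -- Bootstrap: the truncated part of the form is controlled by `B`, and each of two remainders is
  -- 1/3 of another element of `S`. Solving the resulting inequality for `sSup S` gives 16/3.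
  have hstep : ∀ r ∈ S, r ≤ 16 / 9 * B + 2 / 3 * sSup S := by
    rintro _ ⟨m, u, v, hu, hv, rfl⟩
    -- Scaled by `c`, the map from a vector to its Rademacher sum is an isometry into functions on
    -- the sign cube, where coordinates can be truncated.
    set c : ℝ := √((2 : ℝ) ^ m)⁻¹ with hc
    have hc2 : c * c = ((2 : ℝ) ^ m)⁻¹ := Real.mul_self_sqrt (by positivity)
    have hsum : ∀ (F : (Fin m → ℤˣ) → ℝ), ∑ ε, (c * F ε) ^ 2 = signAvg fun ε => F ε ^ 2 := by
      intro F
      simp only [signAvg, ← hc2, Finset.mul_sum]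
      exact Finset.sum_congr rfl fun ε _ => by ring
    have hfull : ∀ u : Fin m → ℝ, ∑ k, u k ^ 2 ≤ 1 →
        ∑ ε, (c * signSum u ε) ^ 2 ≤ 1 := fun u hu => by
      rw [hsum, signAvg_signSum_sq]; exact hu
    have hclip : ∀ u : Fin m → ℝ, ∑ k, u k ^ 2 ≤ 1 →
        ∑ ε, (c * clip (signSum u ε)) ^ 2 ≤ 1 := fun u hu => by
      rw [hsum]
      exact (signAvg_mono fun ε => clip_sq_le _).trans ((signAvg_signSum_sq u).trans_le hu)
    have hrest : ∀ u : Fin m → ℝ, ∑ k, u k ^ 2 ≤ 1 →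
        ∑ ε, (c * (3 * (signSum u ε - clip (signSum u ε)))) ^ 2 ≤ 1 := fun u hu => by
      rw [hsum]
      have h1 : signAvg (fun ε => (3 * (signSum u ε - clip (signSum u ε))) ^ 2)
          ≤ signAvg fun ε => 1 / 3 * signSum u ε ^ 4 := signAvg_mono fun ε => by
        have := sub_clip_sq_le (signSum u ε)
        nlinarith
      rw [signAvg_mul_left] at h1
      have h2 := signAvg_signSum_pow_four_le u
      have h3 : 0 ≤ ∑ k, u k ^ 2 := Finset.sum_nonneg fun k _ => sq_nonneg _
      nlinarith
    have e0 : gramForm M u v = gramForm M (fun i ε => c * signSum (u i) ε)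
        (fun j ε => c * signSum (v j) ε) := by
      unfold gramForm
      refine Finset.sum_congr rfl fun i _ => Finset.sum_congr rfl fun j _ => ?_
      rw [← signAvg_signSum_mul, signAvg, ← hc2, Finset.mul_sum]
      congr 1
      exact Finset.sum_congr rfl fun ε _ => by ring
    -- XY = X'Y' + (X - X')Y + X'(Y - Y') with X', Y' the truncations; the factor 3 renormalizes the
    -- errors to norm at most 1.
    have e1 : gramForm M u v =
        gramForm M (fun i ε => c * clip (signSum (u i) ε)) (fun j ε => c * clip (signSum (v j) ε))
        + 1 / 3 * gramForm M (fun i ε => c * (3 * (signSum (u i) ε - clip (signSum (u i) ε))))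
          (fun j ε => c * signSum (v j) ε)
        + 1 / 3 * gramForm M (fun i ε => c * clip (signSum (u i) ε))
          (fun j ε => c * (3 * (signSum (v j) ε - clip (signSum (v j) ε)))) := by
      rw [e0]
      simp only [gramForm_eq_sum, Finset.mul_sum, ← Finset.sum_add_distrib]
      refine Finset.sum_congr rfl fun k _ => Finset.sum_congr rfl fun i _ =>
        Finset.sum_congr rfl fun j _ => by ring
    have b1 : gramForm M (fun i ε => c * clip (signSum (u i) ε))
        (fun j ε => c * clip (signSum (v j) ε)) ≤ 16 / 9 * B := by
      rw [gramForm_eq_sum]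
      have : ∀ ε : Fin m → ℤˣ, ∑ i, ∑ j, M i j * (c * clip (signSum (u i) ε))
          * (c * clip (signSum (v j) ε)) ≤ ((2 : ℝ) ^ m)⁻¹ * (16 / 9 * B) := by
        intro ε
        -- Rescaling the truncations into [-1, 1] costs (4/3)² = 16/9.
        have hb : ∀ x, |3 / 4 * clip x| ≤ 1 := fun x => by
          rw [abs_mul, abs_of_pos (by norm_num : (0 : ℝ) < 3 / 4)]
          linarith [abs_clip_le x]
        have := hB (fun i => 3 / 4 * clip (signSum (u i) ε))
          (fun j => 3 / 4 * clip (signSum (v j) ε)) (fun i => hb _) (fun j => hb _)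
        calc _ = ((2 : ℝ) ^ m)⁻¹ * (16 / 9 * ∑ i, ∑ j, M i j * (3 / 4 * clip (signSum (u i) ε))
              * (3 / 4 * clip (signSum (v j) ε))) := by
              rw [← hc2]
              simp only [Finset.mul_sum]
              refine Finset.sum_congr rfl fun i _ => Finset.sum_congr rfl fun j _ => by ring
          _ ≤ _ := by gcongr
      refine (Finset.sum_le_sum fun ε _ => this ε).trans_eq ?_
      simp
    have b2 := le_csSup hS (exists_fin_gramForm_eq M _ _ (fun i => hrest (u i) (hu i))
      fun j => hfull (v j) (hv j))
    have b3 := le_csSup hS (exists_fin_gramForm_eq M _ _ (fun i => hclip (u i) (hu i))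
      fun j => hrest (v j) (hv j))
    rw [e1]
    linarith
  have hT := csSup_le hne hstep
  have := le_csSup hS (exists_fin_gramForm_eq M u v hu hv)
  linarith

/-- A bound of a bilinear form on sign vectors extends to the cube. -/
theorem bilin_le_of_forall_sign {B : ℝ}
    (hB : ∀ (x : α → ℤˣ) (z : β → ℤˣ),
      ∑ i, ∑ j, M i j * ((x i : ℤ) : ℝ) * ((z j : ℤ) : ℝ) ≤ B)
    (x : α → ℝ) (z : β → ℝ) (hx : ∀ i, |x i| ≤ 1) (hz : ∀ j, |z j| ≤ 1) :
    ∑ i, ∑ j, M i j * x i * z j ≤ B := by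
  have sgn : ∀ t : ℝ, ∃ s : ℤˣ, ∀ r : ℝ, |r| ≤ 1 → t * r ≤ t * ((s : ℤ) : ℝ) := by
    intro t
    rcases le_total 0 t with h | h
    · exact ⟨1, fun r hr => by
        push_cast; exact mul_le_mul_of_nonneg_left ((abs_le.1 hr).2) h⟩
    · exact ⟨-1, fun r hr => by
        push_cast; exact mul_le_mul_of_nonpos_left ((abs_le.1 hr).1) h⟩
  choose s hs using sgn
  let x' : α → ℤˣ := fun i => s (∑ j, M i j * z j)
  let z' : β → ℤˣ := fun j => s (∑ i, M i j * ((x' i : ℤ) : ℝ))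
  calc ∑ i, ∑ j, M i j * x i * z j = ∑ i, (∑ j, M i j * z j) * x i := by
        refine Finset.sum_congr rfl fun i _ => ?_
        rw [Finset.sum_mul]
        exact Finset.sum_congr rfl fun j _ => by ring
    _ ≤ ∑ i, (∑ j, M i j * z j) * ((x' i : ℤ) : ℝ) :=
        Finset.sum_le_sum fun i _ => hs _ _ (hx i)
    _ = ∑ j, (∑ i, M i j * ((x' i : ℤ) : ℝ)) * z j := by
        simp only [Finset.sum_mul]
        rw [Finset.sum_comm]
        exact Finset.sum_congr rfl fun j _ => Finset.sum_congr rfl fun i _ => by ring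
    _ ≤ ∑ j, (∑ i, M i j * ((x' i : ℤ) : ℝ)) * ((z' j : ℤ) : ℝ) :=
        Finset.sum_le_sum fun j _ => hs _ _ (hz j)
    _ = ∑ i, ∑ j, M i j * ((x' i : ℤ) : ℝ) * ((z' j : ℤ) : ℝ) := by
        simp only [Finset.sum_mul]
        rw [Finset.sum_comm]
    _ ≤ B := hB x' z'

end gramForm

/-! ### Positive semidefinite forms and the top eigenvector. -/

/-- The quadratic form `xᵀ Y x`. -/
def quadForm {n : ℕ} (Y : Matrix (Fin n) (Fin n) ℝ) (x : Fin n → ℝ) : ℝ :=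
  ∑ u, ∑ v, x u * Y u v * x v

theorem sq_sum_eq_sum_sum {ι : Type*} [Fintype ι] (f : ι → ℝ) :
    (∑ i, f i) ^ 2 = ∑ i, ∑ j, f i * f j := by
  rw [sq, Finset.sum_mul_sum]

theorem quadForm_eq_dotProduct {n : ℕ} (Y : Matrix (Fin n) (Fin n) ℝ) (x : Fin n → ℝ) :
    quadForm Y x = star x ⬝ᵥ Y.mulVec x := by
  simp only [quadForm, dotProduct, Matrix.mulVec, Finset.mul_sum, Pi.star_apply, star_trivial,
    mul_assoc]

theorem posSemidef_of_quadForm_nonneg {n : ℕ} {Y : Matrix (Fin n) (Fin n) ℝ}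
    (hs : ∀ u v, Y u v = Y v u) (h : ∀ x, 0 ≤ quadForm Y x) : Y.PosSemidef := by
  refine Matrix.PosSemidef.of_dotProduct_mulVec_nonneg ?_ fun x => ?_
  · ext u v
    simpa using hs v u
  · rw [← quadForm_eq_dotProduct]; exact h x

open scoped MatrixOrder Matrix.Norms.L2Operator in
theorem exists_gram_of_posSemidef {n : ℕ} {Y : Matrix (Fin n) (Fin n) ℝ} (hY : Y.PosSemidef) :
    ∃ B : Fin n → Fin n → ℝ, ∀ u v, Y u v = ∑ k, B u k * B v k := by
  obtain ⟨A, hA⟩ := CStarAlgebra.nonneg_iff_eq_star_mul_self.mp hY.nonneg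
  refine ⟨fun u k => A k u, fun u v => ?_⟩
  rw [hA, Matrix.mul_apply]
  simp

theorem posSemidef_symm {n : ℕ} {Y : Matrix (Fin n) (Fin n) ℝ} (hY : Y.PosSemidef) (u v : Fin n) :
    Y u v = Y v u := by
  simpa using hY.1.apply v u

theorem quadForm_nonneg {n : ℕ} {Y : Matrix (Fin n) (Fin n) ℝ} (hY : Y.PosSemidef)
    (x : Fin n → ℝ) : 0 ≤ quadForm Y x := by
  rw [quadForm_eq_dotProduct]; exact hY.dotProduct_mulVec_nonneg x

/-- In a Gram factorization the form is a sum of squares; apply Cauchy–Schwarz to each. -/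
theorem quadForm_le_trace_mul {n : ℕ} {Y : Matrix (Fin n) (Fin n) ℝ} (hY : Y.PosSemidef)
    (x : Fin n → ℝ) : quadForm Y x ≤ (∑ u, Y u u) * ∑ u, x u ^ 2 := by
  obtain ⟨B, hB⟩ := exists_gram_of_posSemidef hY
  have h1 : quadForm Y x = ∑ k, (∑ u, B u k * x u) ^ 2 := by
    simp only [quadForm, hB, sq_sum_eq_sum_sum, Finset.mul_sum, Finset.sum_mul]
    rw [Finset.sum_comm]
    conv_lhs => enter [2, v]; rw [Finset.sum_comm]
    rw [Finset.sum_comm]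
    refine Finset.sum_congr rfl fun k _ => ?_
    rw [Finset.sum_comm]
    exact Finset.sum_congr rfl fun u _ => Finset.sum_congr rfl fun v _ => by ring
  have h2 : ∑ u, Y u u = ∑ k, ∑ u, B u k ^ 2 := by
    simp only [hB, sq]
    exact Finset.sum_comm
  rw [h1, h2, Finset.sum_mul]
  exact Finset.sum_le_sum fun k _ => Finset.sum_mul_sq_le_sq_mul_sq _ _ _

/-- The spectrum of κI - Y consists of the numbers κ - θ ≥ 0, with θ an eigenvalue of `Y`. -/
theorem quadForm_le_of_isGreatest {n : ℕ} {Y : Matrix (Fin n) (Fin n) ℝ} (hY : Y.PosSemidef)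
    {κ : ℝ} (hκ : IsGreatest {κ' : ℝ | Module.End.HasEigenvalue (Matrix.toLin' Y) κ'} κ)
    (x : Fin n → ℝ) : quadForm Y x ≤ κ * ∑ u, x u ^ 2 := by
  have hps : (algebraMap ℝ (Matrix (Fin n) (Fin n) ℝ) κ - Y).PosSemidef := by
    rw [Matrix.posSemidef_iff_isHermitian_and_spectrum_nonneg]
    refine ⟨?_, fun r hr => ?_⟩
    · refine Matrix.IsHermitian.sub ?_ hY.1
      rw [Algebra.algebraMap_eq_smul_one]
      ext u v
      simp [Matrix.one_apply, eq_comm]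
    · rw [← spectrum.singleton_sub_eq] at hr
      obtain ⟨_, rfl, θ, hθ, rfl⟩ := Set.mem_sub.1 hr
      have : Module.End.HasEigenvalue (Matrix.toLin' Y) θ := by
        rw [Module.End.hasEigenvalue_iff_mem_spectrum, Matrix.spectrum_toLin']
        exact hθ
      have := hκ.2 this
      simpa using this
  have h := quadForm_nonneg hps x
  have e : quadForm (algebraMap ℝ (Matrix (Fin n) (Fin n) ℝ) κ - Y) x
      = κ * ∑ u, x u ^ 2 - quadForm Y x := by
    simp only [quadForm, Matrix.sub_apply, mul_sub, sub_mul, Finset.sum_sub_distrib,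
      Matrix.algebraMap_matrix_apply]
    congr 1
    rw [Finset.mul_sum]
    refine Finset.sum_congr rfl fun u _ => ?_
    rw [Finset.sum_eq_single u (by intro v _ hv; simp [hv.symm]) (by simp)]
    simp
    ring
  linarith

/-- Removing the top eigencomponent leaves a positive semidefinite matrix of trace n - κ, so xᵀYx ≤
(κ/n)⟨x, y⟩² + (n - κ)n. With xᵀYx ≥ 3n²/4 this reads ⟨x, y⟩² ≥ n² - n³/(4κ), and κ ≥ 3n/4 gives
2n²/3. -/
theorem sum_mul_sq_ge_of_quadForm_ge {n : ℕ} (hn : 0 < n) {Y : Matrix (Fin n) (Fin n) ℝ}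
    (hY : Y ∈ sdpFeasible n) {x y : Fin n → ℝ} (hx : ∑ u, x u ^ 2 = n)
    (hq : 3 / 4 * (n : ℝ) ^ 2 ≤ quadForm Y x) (hy : IsTopEigenvector Y y) :
    ∑ u, y u ^ 2 = n ∧ 2 / 3 * (n : ℝ) ^ 2 ≤ (∑ u, x u * y u) ^ 2 := by
  obtain ⟨hps, hdiag, -⟩ := hY
  obtain ⟨⟨κ, hκ, hev⟩, hnorm⟩ := hy
  have hn' : (0 : ℝ) < n := Nat.cast_pos.2 hn
  have hyn : ∑ u, y u ^ 2 = n := by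
    rw [EuclideanSpace.norm_eq, Real.sqrt_inj (Finset.sum_nonneg fun _ _ => sq_nonneg _)
      hn'.le] at hnorm
    simpa using hnorm
  refine ⟨hyn, ?_⟩
  have hκn : 3 / 4 * (n : ℝ) ≤ κ := by
    have := quadForm_le_of_isGreatest hps hκ x
    rw [hx] at this
    by_contra! h
    nlinarith
  have heig : ∀ u, ∑ v, Y u v * y v = κ * y u := fun u => by
    have := congrFun hev.apply_eq_smul u
    simpa [Matrix.mulVec, dotProduct] using this
  set A : Matrix (Fin n) (Fin n) ℝ := fun u v => Y u v - κ / n * (y u * y v) with hA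
  have hquad : ∀ z : Fin n → ℝ, quadForm A z = quadForm Y z - κ / n * (∑ u, z u * y u) ^ 2 := by
    intro z
    simp only [quadForm, hA, mul_sub, sub_mul, Finset.sum_sub_distrib, sq_sum_eq_sum_sum,
      Finset.mul_sum]
    congr 1
    exact Finset.sum_congr rfl fun u _ => Finset.sum_congr rfl fun v _ => by ring
  have hAps : A.PosSemidef := by
    refine posSemidef_of_quadForm_nonneg (fun u v => ?_) fun z => ?_
    · simp only [hA, posSemidef_symm hps u v]; ring
    · rw [hquad]
      set c := ∑ u, z u * y u with hc
      -- On the component of `z` orthogonal to `y`, the form of `Y` equals the form of `A` at `z`.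
      have h0 := quadForm_nonneg hps (fun u => z u - c / n * y u)
      have e1 : ∑ u, ∑ v, z u * Y u v * y v = κ * c := by
        simp only [mul_assoc, ← Finset.mul_sum, heig, hc]
        rw [Finset.mul_sum]
        exact Finset.sum_congr rfl fun u _ => by ring
      have e2 : ∑ u, ∑ v, y u * Y u v * z v = κ * c := by
        rw [Finset.sum_comm, ← e1]
        refine Finset.sum_congr rfl fun u _ => Finset.sum_congr rfl fun v _ => ?_
        rw [posSemidef_symm hps v u]; ring
      have e3 : ∑ u, ∑ v, y u * Y u v * y v = κ * n := by
        simp only [mul_assoc, ← Finset.mul_sum, heig]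
        rw [← hyn, Finset.mul_sum]
        exact Finset.sum_congr rfl fun u _ => by ring
      have e4 : quadForm Y (fun u => z u - c / n * y u) = quadForm Y z
          - c / n * (∑ u, ∑ v, z u * Y u v * y v) - c / n * (∑ u, ∑ v, y u * Y u v * z v)
          + c / n * (c / n) * (∑ u, ∑ v, y u * Y u v * y v) := by
        simp only [quadForm, Finset.mul_sum, ← Finset.sum_sub_distrib, ← Finset.sum_add_distrib]
        exact Finset.sum_congr rfl fun u _ => Finset.sum_congr rfl fun v _ => by ring
      rw [e4, e1, e2, e3] at h0
      have e5 : quadForm Y z - c / n * (κ * c) - c / n * (κ * c) + c / n * (c / n) * (κ * n)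
          = quadForm Y z - κ / n * c ^ 2 := by
        field_simp; ring
      rwa [e5] at h0
  have htr := quadForm_le_trace_mul hAps x
  have htrA : ∑ u, A u u = n - κ := by
    simp only [hA, Finset.sum_sub_distrib, hdiag, ← Finset.mul_sum, ← sq, hyn]
    simp
    field_simp
  rw [hquad, htrA, hx] at htr
  set c := ∑ u, x u * y u
  have h1 : κ / n * c ^ 2 ≥ κ * n - n ^ 2 / 4 := by nlinarith
  have h2 : κ / n * c ^ 2 * n = κ * c ^ 2 := by field_simp
  have h3 : κ * c ^ 2 ≥ (κ * n - n ^ 2 / 4) * n := by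
    rw [← h2]; exact mul_le_mul_of_nonneg_right h1 hn'.le
  have h4 : (κ * n - n ^ 2 / 4) * n ≥ κ * (2 / 3 * (n : ℝ) ^ 2) := by nlinarith [sq_nonneg (n : ℝ)]
  exact le_of_mul_le_mul_left (h4.le.trans h3.le) (by linarith : 0 < κ)

/-! ### Rounding the eigenvector. -/

theorem typeVec_sq {n : ℕ} (σ : Fin n → ℤˣ) (u : Fin n) : typeVec σ u ^ 2 = 1 := by
  rcases Int.units_eq_one_or (σ u) with h | h <;> simp [typeVec, h]

theorem typeVec_eq_or {n : ℕ} (σ : Fin n → ℤˣ) (u : Fin n) :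
    typeVec σ u = 1 ∨ typeVec σ u = -1 := by
  rcases Int.units_eq_one_or (σ u) with h | h <;> simp [typeVec, h]

theorem sum_typeVec_sq {n : ℕ} (σ : Fin n → ℤˣ) : ∑ u, typeVec σ u ^ 2 = n := by
  simp [typeVec_sq]

/-- Each error, including y_u = 0, contributes at least 1 to ‖σ - y‖² = 2n - 2⟨σ, y⟩ ≤ 2n/5. -/
theorem card_ne_sign_le {n : ℕ} (σ : Fin n → ℤˣ) (y : Fin n → ℝ) (hy : ∑ u, y u ^ 2 = n)
    (h : 4 / 5 * (n : ℝ) ≤ ∑ u, typeVec σ u * y u) :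
    ((Finset.univ.filter fun u => typeVec σ u ≠ Real.sign (y u)).card : ℝ) ≤ 2 / 5 * n := by
  have h1 : ((Finset.univ.filter fun u => typeVec σ u ≠ Real.sign (y u)).card : ℝ)
      ≤ ∑ u, (typeVec σ u - y u) ^ 2 := by
    rw [Finset.card_filter]
    push_cast
    refine Finset.sum_le_sum fun u _ => ?_
    split_ifs with hne
    · rcases lt_trichotomy (y u) 0 with hu | hu | hu
      · rw [Real.sign_of_neg hu] at hne
        rcases typeVec_eq_or σ u with e | e
        · rw [e]; nlinarith
        · exact absurd e hne
      · rw [hu, sub_zero, typeVec_sq]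
      · rw [Real.sign_of_pos hu] at hne
        rcases typeVec_eq_or σ u with e | e
        · exact absurd e hne
        · rw [e]; nlinarith
    · positivity
  have h2 : ∑ u, (typeVec σ u - y u) ^ 2
      = ∑ u, typeVec σ u ^ 2 + ∑ u, y u ^ 2 - 2 * ∑ u, typeVec σ u * y u := by
    simp only [Finset.mul_sum, ← Finset.sum_sub_distrib, ← Finset.sum_add_distrib]
    exact Finset.sum_congr rfl fun u _ => by ring
  rw [h2, sum_typeVec_sq, hy] at h1
  linarith

theorem overlap_sign_ge {n : ℕ} (hn : 0 < n) (σ : Fin n → ℤˣ) (y : Fin n → ℝ)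
    (hy : ∑ u, y u ^ 2 = n) (h : 2 / 3 * (n : ℝ) ^ 2 ≤ (∑ u, typeVec σ u * y u) ^ 2) :
    1 / 10 ≤ overlap (typeVec σ) (fun u => Real.sign (y u)) := by
  have hn' : (0 : ℝ) < n := Nat.cast_pos.2 hn
  have habs : 4 / 5 * (n : ℝ) ≤ |∑ u, typeVec σ u * y u| := by
    refine abs_le_of_sq_le_sq' ?_ (abs_nonneg _) |>.2
    rw [sq_abs]; nlinarith
  suffices hmin : min (hammingDist (typeVec σ) (fun u => Real.sign (y u)) : ℝ)
      (hammingDist (typeVec σ) (-fun u => Real.sign (y u)) : ℝ) ≤ 2 / 5 * n by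
    have : 1 / (n : ℝ) * min (hammingDist (typeVec σ) (fun u => Real.sign (y u)) : ℝ)
        (hammingDist (typeVec σ) (-fun u => Real.sign (y u)) : ℝ) ≤ 2 / 5 := by
      rw [one_div, inv_mul_le_iff₀ hn']; linarith
    unfold overlap
    linarith
  rcases abs_choice (∑ u, typeVec σ u * y u) with e | e
  · refine (min_le_left _ _).trans ?_
    refine le_of_eq_of_le ?_ (card_ne_sign_le σ y hy (by rwa [← e]))
    unfold hammingDist
    congr!
  · refine (min_le_right _ _).trans ?_
    have := card_ne_sign_le σ (-y) (by simpa using hy) (by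
      simpa [Finset.sum_neg_distrib] using habs.trans_eq e)
    simp only [Pi.neg_apply, Real.sign_neg] at this
    refine le_of_eq_of_le ?_ this
    unfold hammingDist
    congr!

/-! ### A feasible matrix close to σσᵀ. -/

/-- When the types are unbalanced, σσᵀ violates ⟨J, Y⟩ = 0. Shrinking the larger class to the value
`r` balances the vector; a positive semidefinite term supported on that class, with zero row sums,
restores the unit diagonal. -/
theorem exists_feasible_quadForm_ge {n : ℕ} (hn : 3 ≤ n) (σ : Fin n → ℤˣ) :
    ∃ Y ∈ sdpFeasible n, ((n : ℝ) - |∑ u, typeVec σ u|) ^ 2 ≤ quadForm Y (typeVec σ) := by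
  obtain ⟨s, hs, hst⟩ : ∃ s : ℝ, s ^ 2 = 1 ∧ s * ∑ u, typeVec σ u = |∑ u, typeVec σ u| := by
    rcases abs_choice (∑ u, typeVec σ u) with h | h
    · exact ⟨1, by norm_num, by rw [h, one_mul]⟩
    · exact ⟨-1, by norm_num, by rw [h]; ring⟩
  set t : ℝ := |∑ u, typeVec σ u| with ht
  have ht0 : 0 ≤ t := abs_nonneg _
  have hn' : (3 : ℝ) ≤ n := by exact_mod_cast hn
  have htn : t ≤ n := by
    refine (Finset.abs_sum_le_sum_abs _ _).trans_eq ?_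
    have : ∀ u, |typeVec σ u| = 1 := fun u => by
      rcases typeVec_eq_or σ u with h | h <;> simp [h]
    simp [this]
  -- `f` is the indicator of the larger class, `p` its size, and `r` the ratio of the smaller class
  -- size to `p`.
  set f : Fin n → ℝ := fun u => (1 + s * typeVec σ u) / 2 with hf
  set p : ℝ := (n + t) / 2 with hp
  set r : ℝ := (n - t) / (n + t) with hr
  have hp1 : 1 < p := by rw [hp]; linarith
  have hr1 : r ≤ 1 := by rw [hr, div_le_one (by linarith)]; linarith
  have hr0 : 0 ≤ r := div_nonneg (by linarith) (by linarith)
  have hrp : p * r = (n - t) / 2 := by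
    rw [hp, hr]
    have : (n : ℝ) + t ≠ 0 := by linarith
    field_simp
  -- Chosen so that the diagonal on the larger class, r² + c(p - 1), equals 1; n ≥ 3 ensures p > 1.
  set c : ℝ := (1 - r ^ 2) / (p - 1) with hc
  have hc0 : 0 ≤ c := div_nonneg (by nlinarith) (by linarith)
  have hcp : c * (p - 1) = 1 - r ^ 2 := div_mul_cancel₀ _ (by linarith)
  have hff : ∀ u, f u * f u = f u := fun u => by
    have := typeVec_sq σ u
    simp only [hf]
    linear_combination (s ^ 2 / 4) * this + (1 / 4) * hs
  have hfs : ∑ u, f u = p := by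
    simp only [hf, ← Finset.sum_div, Finset.sum_add_distrib, ← Finset.mul_sum, hst]
    simp [hp]
  set z : Fin n → ℝ := fun u => f u * (1 + r) - 1 with hz
  have hzs : ∑ u, z u = 0 := by
    simp only [hz, Finset.sum_sub_distrib, ← Finset.sum_mul, hfs]
    simp
    linear_combination hrp
  set Y : Matrix (Fin n) (Fin n) ℝ := fun u v =>
    z u * z v + c * ((if u = v then p * f u else 0) - f u * f v) with hY
  have hbil : ∀ x : Fin n → ℝ, quadForm Y x = (∑ u, z u * x u) ^ 2
      + c * (p * ∑ u, (f u * x u) ^ 2 - (∑ u, f u * x u) ^ 2) := by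
    intro x
    have e : ∑ u, (f u * x u) ^ 2 = ∑ u, ∑ v, if u = v then f u * x u * x v else 0 := by
      simp only [Finset.sum_ite_eq, Finset.mem_univ, if_true]
      refine Finset.sum_congr rfl fun u _ => ?_
      linear_combination (x u ^ 2) * hff u
    rw [e]
    simp only [quadForm, hY, sq_sum_eq_sum_sum, Finset.mul_sum, ← Finset.sum_sub_distrib,
      ← Finset.sum_add_distrib]
    refine Finset.sum_congr rfl fun u _ => Finset.sum_congr rfl fun v _ => ?_
    split_ifs <;> ring
  have hCS : ∀ x : Fin n → ℝ, 0 ≤ c * (p * ∑ u, (f u * x u) ^ 2 - (∑ u, f u * x u) ^ 2) := by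
    intro x
    refine mul_nonneg hc0 (sub_nonneg.2 ?_)
    have h := Finset.sum_mul_sq_le_sq_mul_sq Finset.univ f (fun u => f u * x u)
    have e1 : ∑ u, f u ^ 2 = p := by simp only [sq, hff, hfs]
    have e2 : ∑ u, f u * (f u * x u) = ∑ u, f u * x u := by simp only [← mul_assoc, hff]
    rwa [e1, e2] at h
  refine ⟨Y, ⟨posSemidef_of_quadForm_nonneg (fun u v => ?_) fun x => ?_, fun u => ?_, ?_⟩, ?_⟩
  · simp only [hY]
    by_cases h : u = v
    · simp [h]
    · simp only [h, Ne.symm h, if_false]; ring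
  · rw [hbil]; have := hCS x; positivity
  · simp only [hY, hz, if_true]
    linear_combination (1 + r) ^ 2 * hff u - c * hff u + f u * hcp
  · have h := hbil fun _ => 1
    have e : quadForm Y (fun _ => 1) = ∑ u, ∑ v, Y u v := by simp [quadForm]
    rw [e] at h
    rw [h]
    simp only [mul_one, hzs, hfs, sq, hff]
    ring
  · rw [hbil]
    have h1 : (∑ u, z u * typeVec σ u) ^ 2 = ((n : ℝ) - t) ^ 2 := by
      have e : ∀ u, s * (z u * typeVec σ u) = (r - 1) / 2 * (s * typeVec σ u)
          + (1 + r) / 2 := fun u => by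
        have := typeVec_sq σ u
        simp only [hz, hf]
        linear_combination ((1 + r) / 2 * s ^ 2) * this + (1 + r) / 2 * hs
      have e2 : s * ∑ u, z u * typeVec σ u = n - t := by
        rw [Finset.mul_sum, Finset.sum_congr rfl fun u _ => e u, Finset.sum_add_distrib,
          ← Finset.mul_sum, ← Finset.mul_sum, hst]
        simp only [Finset.sum_const, Finset.card_univ, Fintype.card_fin, nsmul_eq_mul]
        rw [hp] at hrp
        linear_combination hrp
      rw [← e2, mul_pow, hs, one_mul]
    rw [h1]
    have := hCS (typeVec σ)
    linarith

/-! ### The semidefinite program under a cut norm bound. -/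

/-- The conditional mean of the weighted adjacency matrix given the types, where `α / n` is the
mean weight of a pair of equal types and `β / n` that of a pair of different types. -/
noncomputable def meanMatrix {n : ℕ} (α β : ℝ) (σ : Fin n → ℤˣ) : Matrix (Fin n) (Fin n) ℝ :=
  fun u v => if u = v then 0 else if σ u = σ v then α / n else β / n

/-- Off the diagonal the mean is ((α - β)/2n) σσᵀ + ((α + β)/2n) J. The J-part vanishes on `Y`, and
the unit diagonal makes the diagonal correction exactly α. -/
theorem sum_meanMatrix_mul {n : ℕ} (hn : 0 < n) (α β : ℝ) (σ : Fin n → ℤˣ)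
    {Y : Matrix (Fin n) (Fin n) ℝ} (hY : Y ∈ sdpFeasible n) :
    ∑ u, ∑ v, meanMatrix α β σ u v * Y u v
      = (α - β) / (2 * n) * quadForm Y (typeVec σ) - α := by
  have hn' : (n : ℝ) ≠ 0 := by positivity
  obtain ⟨-, hd, h0⟩ := hY
  have e : ∀ u v, meanMatrix α β σ u v * Y u v = (α - β) / (2 * n) *
      (typeVec σ u * Y u v * typeVec σ v) + (α + β) / (2 * n) * Y u v
        - (if u = v then α / n * Y u v else 0) := by
    intro u v
    unfold meanMatrix
    by_cases huv : u = v
    · subst huv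
      have := typeVec_sq σ u
      simp only [if_true]
      field_simp
      linear_combination -(Y u u * (α - β)) * this
    · simp only [huv, if_false]
      have : (if σ u = σ v then α / (n : ℝ) else β / n)
          = (α - β) / (2 * n) * (typeVec σ u * typeVec σ v) + (α + β) / (2 * n) := by
        rcases Int.units_eq_one_or (σ u) with h | h <;>
          rcases Int.units_eq_one_or (σ v) with h' | h' <;>
          simp [typeVec, h, h', show (1 : ℤˣ) ≠ -1 by decide, show (-1 : ℤˣ) ≠ 1 by decide] <;>
          field_simp <;> ring
      rw [this]; ring
  simp only [e, Finset.sum_add_distrib, Finset.sum_sub_distrib, ← Finset.mul_sum, h0, quadForm,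
    Finset.sum_ite_eq, Finset.mem_univ, if_true, hd]
  simp
  field_simp

theorem sum_mul_le_of_feasible {n : ℕ} {M : Fin n → Fin n → ℝ} {B : ℝ}
    (hB : ∀ x z : Fin n → ℤˣ, ∑ u, ∑ v, M u v * ((x u : ℤ) : ℝ) * ((z v : ℤ) : ℝ) ≤ B)
    {Y : Matrix (Fin n) (Fin n) ℝ} (hY : Y ∈ sdpFeasible n) :
    |∑ u, ∑ v, M u v * Y u v| ≤ 16 / 3 * B := by
  obtain ⟨hps, hd, -⟩ := hY
  obtain ⟨A, hA⟩ := exists_gram_of_posSemidef hps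
  have hA1 : ∀ u, ∑ k, A u k ^ 2 ≤ 1 := fun u => by
    rw [← hd u, hA]; simp [sq]
  have e : ∑ u, ∑ v, M u v * Y u v = gramForm M A A := by simp [gramForm, hA]
  have h1 := gramForm_le_of_forall_abs_le_one M (bilin_le_of_forall_sign M hB) A A hA1 hA1
  -- Negating one family of vectors gives the lower bound with the same `B`.
  have h2 := gramForm_le_of_forall_abs_le_one M (bilin_le_of_forall_sign M hB)
    (fun u k => -1 * A u k) (fun u k => 1 * A u k) (by simpa using hA1) (by simpa using hA1)
  rw [gramForm_smul] at h2
  rw [e, abs_le]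
  constructor <;> linarith

/-- The deterministic part of the analysis: if the types are nearly balanced and the weighted
adjacency matrix is close to its conditional mean in cut norm, the overlap is at least `1/10`. -/
theorem overlap_ge_of_cutNorm_le {n : ℕ} (hn : 3 ≤ n) {α β B : ℝ} (σ : Fin n → ℤˣ)
    {W Y : Matrix (Fin n) (Fin n) ℝ} {y : Fin n → ℝ}
    (hg : 0 < α - β) (hbal : |∑ u, typeVec σ u| ≤ n / 50) (hBg : 512 * B ≤ 5 * (α - β) * n)
    (hB : ∀ x z : Fin n → ℤˣ,
      ∑ u, ∑ v, (W u v - meanMatrix α β σ u v) * ((x u : ℤ) : ℝ) * ((z v : ℤ) : ℝ) ≤ B)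
    (hY : IsSDPSolution W Y) (hy : IsTopEigenvector Y y) :
    1 / 10 ≤ overlap (typeVec σ) (fun u => Real.sign (y u)) := by
  have hn0 : 0 < n := by omega
  have hn' : (0 : ℝ) < n := Nat.cast_pos.2 hn0
  obtain ⟨Y₀, hY₀, hq₀⟩ := exists_feasible_quadForm_ge hn σ
  have hopt : ∑ u, ∑ v, W u v * Y₀ u v ≤ ∑ u, ∑ v, W u v * Y u v := hY.2 hY₀
  have h1 := (abs_le.1 (sum_mul_le_of_feasible hB hY.1)).2
  have h2 := (abs_le.1 (sum_mul_le_of_feasible hB hY₀)).1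
  simp only [sub_mul, Finset.sum_sub_distrib] at h1 h2
  rw [sum_meanMatrix_mul hn0 α β σ hY.1] at h1
  rw [sum_meanMatrix_mul hn0 α β σ hY₀] at h2
  set q := quadForm Y (typeVec σ)
  set q₀ := quadForm Y₀ (typeVec σ)
  -- Optimality of `Y` against `Y₀`, with an error 16B/3 for each. Then `hBg` gives q₀ - q ≤ 5n²/24,
  -- while q₀ ≥ (49/50)²n² ≥ 23n²/24, so q ≥ 3n²/4.
  have h3 : (α - β) / (2 * n) * (q₀ - q) ≤ 32 / 3 * B := by linarith
  have h4 : (α - β) * (q₀ - q) ≤ (α - β) * (5 / 24 * n ^ 2) := by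
    have e : (α - β) / (2 * n) * (q₀ - q) * (2 * n) = (α - β) * (q₀ - q) := by field_simp
    have := mul_le_mul_of_nonneg_right h3 (by positivity : (0 : ℝ) ≤ 2 * n)
    rw [e] at this
    nlinarith
  have h5 := le_of_mul_le_mul_left h4 hg
  have h6 : 23 / 24 * (n : ℝ) ^ 2 ≤ q₀ := by nlinarith
  obtain ⟨hyn, hc⟩ := sum_mul_sq_ge_of_quadForm_ge hn0 hY.1 (sum_typeVec_sq σ) (by linarith) hy
  exact overlap_sign_ge hn0 σ y hyn hc

/-! ### Concentration in cut norm given the types. -/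

theorem sum_sum_eq_sum_vertexPair {n : ℕ} (h : Fin n → Fin n → ℝ) :
    ∑ u, ∑ v, h u v = ∑ e : VertexPair n, (h e.1.1 e.1.2 + h e.1.2 e.1.1) + ∑ u, h u u := by
  have key : ∀ g : Fin n → Fin n → ℝ,
      ∑ u, ∑ v, (if u < v then g u v else 0) = ∑ e : VertexPair n, g e.1.1 e.1.2 := by
    intro g
    rw [← Fintype.sum_prod_type' (f := fun u v => if u < v then g u v else 0),
      ← Finset.sum_filter]
    exact Finset.sum_subtype _ (by simp) fun p : Fin n × Fin n => g p.1 p.2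
  have e : ∀ u v, h u v = (if u < v then h u v else 0) + (if v < u then h u v else 0)
      + (if u = v then h u v else 0) := by
    intro u v
    rcases lt_trichotomy u v with huv | huv | huv
    · simp [huv, huv.le, huv.ne]
    · simp [huv]
    · simp [huv, huv.le, huv.ne']
  have hswap : ∑ u, ∑ v, (if v < u then h u v else 0) = ∑ e : VertexPair n, h e.1.2 e.1.1 := by
    rw [Finset.sum_comm]
    exact key fun u v => h v u
  conv_lhs => enter [2, u, 2, v]; rw [e u v]
  simp only [Finset.sum_add_distrib, key, hswap, Finset.sum_ite_eq, Finset.mem_univ, if_true]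

theorem card_vertexPair_le (n : ℕ) : (Fintype.card (VertexPair n) : ℝ) ≤ (n : ℝ) ^ 2 / 2 := by
  have h := sum_sum_eq_sum_vertexPair (n := n) fun _ _ => 1
  simp only [Finset.sum_const, Finset.card_univ, Fintype.card_fin, nsmul_eq_mul, mul_one] at h
  have : (0 : ℝ) ≤ n := Nat.cast_nonneg n
  nlinarith

section model
variable {𝓛 : Type*} {n : ℕ} {p q : ℝ} {μ ν w : 𝓛 → ℝ}

theorem pairFactor_nonneg (hp0 : 0 ≤ p) (hp1 : p ≤ 1) (hq0 : 0 ≤ q) (hq1 : q ≤ 1)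
    (hμ : ∀ ℓ, 0 ≤ μ ℓ) (hν : ∀ ℓ, 0 ≤ ν ℓ) (s t : ℤˣ) (o : Option 𝓛) :
    0 ≤ pairFactor p q μ ν s t o := by
  cases o with
  | none => simp only [pairFactor]; split_ifs <;> linarith
  | some ℓ =>
    simp only [pairFactor]
    split_ifs
    · exact mul_nonneg hp0 (hμ ℓ)
    · exact mul_nonneg hq0 (hν ℓ)

theorem abs_edgeWeight_le (hw : ∀ ℓ, w ℓ ∈ Set.Icc (-1 : ℝ) 1) (o : Option 𝓛) :
    |edgeWeight w o| ≤ 1 := by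
  cases o with
  | none => simp [edgeWeight]
  | some ℓ => exact abs_le.2 (hw ℓ)

/-- The centered weights as a linear statistic of the pairs. -/
theorem sum_weightMatrix_sub_mul {α β : ℝ} (σ : Fin n → ℤˣ) (G : LabeledGraph n 𝓛)
    (x z : Fin n → ℝ) :
    ∑ u, ∑ v, (weightMatrix w G u v - meanMatrix α β σ u v) * x u * z v
      = ∑ e : VertexPair n, (x e.1.1 * z e.1.2 + x e.1.2 * z e.1.1)
          * (edgeWeight w (G e) - meanMatrix α β σ e.1.1 e.1.2) := by
  rw [sum_sum_eq_sum_vertexPair]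
  have hdiag : ∀ u, (weightMatrix w G u u - meanMatrix α β σ u u) * x u * z u = 0 := fun u => by
    simp [weightMatrix, meanMatrix]
  simp only [hdiag, Finset.sum_const_zero, add_zero]
  refine Finset.sum_congr rfl fun e _ => ?_
  have h1 : weightMatrix w G e.1.1 e.1.2 = edgeWeight w (G e) := by
    simp [weightMatrix, e.2]
  have h2 : weightMatrix w G e.1.2 e.1.1 = edgeWeight w (G e) := by
    simp [weightMatrix, e.2, e.2.not_gt]
  have h3 : meanMatrix α β σ e.1.2 e.1.1 = meanMatrix α β σ e.1.1 e.1.2 := by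
    simp [meanMatrix, eq_comm]
  rw [h1, h2, h3]
  ring

/-- The conditional probability of a labeled graph given the types. -/
def graphProb (p q : ℝ) (μ ν : 𝓛 → ℝ) (σ : Fin n → ℤˣ) (G : LabeledGraph n 𝓛) : ℝ :=
  ∏ e : VertexPair n, pairFactor p q μ ν (σ e.1.1) (σ e.1.2) (G e)

theorem graphProb_nonneg (hp0 : 0 ≤ p) (hp1 : p ≤ 1) (hq0 : 0 ≤ q) (hq1 : q ≤ 1)
    (hμ : ∀ ℓ, 0 ≤ μ ℓ) (hν : ∀ ℓ, 0 ≤ ν ℓ) (σ : Fin n → ℤˣ) (G : LabeledGraph n 𝓛) :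
    0 ≤ graphProb p q μ ν σ G :=
  Finset.prod_nonneg fun _ _ => pairFactor_nonneg hp0 hp1 hq0 hq1 hμ hν _ _ _

variable [Fintype 𝓛]

theorem sum_pairFactor_mul (s t : ℤˣ) (h : Option 𝓛 → ℝ) :
    ∑ o, pairFactor p q μ ν s t o * h o
      = (if s = t then 1 - p else 1 - q) * h none
        + ∑ ℓ, (if s = t then p * μ ℓ else q * ν ℓ) * h (some ℓ) := by
  rw [Fintype.sum_option]
  rfl

theorem sum_pairFactor (hμ_sum : ∑ ℓ, μ ℓ = 1) (hν_sum : ∑ ℓ, ν ℓ = 1) (s t : ℤˣ) :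
    ∑ o, pairFactor p q μ ν s t o = 1 := by
  have := sum_pairFactor_mul (p := p) (q := q) (μ := μ) (ν := ν) s t fun _ => 1
  simp only [mul_one] at this
  rw [this]
  split_ifs <;> simp [← Finset.mul_sum, hμ_sum, hν_sum]

/-- The mean of `edgeWeight` over the state of a pair with types `s` and `t`. -/
theorem sum_pairFactor_mul_edgeWeight (s t : ℤˣ) :
    ∑ o, pairFactor p q μ ν s t o * edgeWeight w o
      = if s = t then ∑ ℓ, p * μ ℓ * w ℓ else ∑ ℓ, q * ν ℓ * w ℓ := by
  rw [sum_pairFactor_mul]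
  split_ifs <;> simp [edgeWeight]

theorem sum_pairFactor_mul_edgeWeight_sq_le (hp0 : 0 ≤ p) (hq0 : 0 ≤ q)
    (hμ : ∀ ℓ, 0 ≤ μ ℓ) (hν : ∀ ℓ, 0 ≤ ν ℓ) (s t : ℤˣ) :
    ∑ o, pairFactor p q μ ν s t o * edgeWeight w o ^ 2 ≤ secondMoment p q μ ν w := by
  rw [sum_pairFactor_mul, secondMoment]
  have h0 : edgeWeight w none ^ 2 = 0 := by simp [edgeWeight]
  rw [h0, mul_zero, zero_add]
  refine Finset.sum_le_sum fun ℓ _ => mul_le_mul_of_nonneg_right ?_ (sq_nonneg _)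
  have h1 := mul_nonneg hp0 (hμ ℓ)
  have h2 := mul_nonneg hq0 (hν ℓ)
  split_ifs <;> linarith

/-- The moment generating function of the centered weight of a pair. -/
theorem sum_pairFactor_mul_exp_le (hp0 : 0 ≤ p) (hp1 : p ≤ 1) (hq0 : 0 ≤ q) (hq1 : q ≤ 1)
    (hμ : ∀ ℓ, 0 ≤ μ ℓ) (hν : ∀ ℓ, 0 ≤ ν ℓ) (hμ_sum : ∑ ℓ, μ ℓ = 1) (hν_sum : ∑ ℓ, ν ℓ = 1)
    (hw : ∀ ℓ, w ℓ ∈ Set.Icc (-1 : ℝ) 1) (s t : ℤˣ) {m θ η : ℝ}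
    (hm : m = ∑ o, pairFactor p q μ ν s t o * edgeWeight w o) (hθ : |θ| ≤ η) (hη : η ≤ 1) :
    ∑ o, pairFactor p q μ ν s t o * Real.exp (θ * (edgeWeight w o - m))
      ≤ Real.exp (η ^ 2 * secondMoment p q μ ν w) := by
  -- eˣ ≤ 1 + x + x² for |x| ≤ 1; this is where bounded weights and η ≤ 1 enter.
  have hexp : ∀ o, Real.exp (θ * edgeWeight w o)
      ≤ 1 + θ * edgeWeight w o + θ ^ 2 * edgeWeight w o ^ 2 := fun o => by
    have h1 : |θ * edgeWeight w o| ≤ 1 := by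
      rw [abs_mul]
      exact mul_le_one₀ (hθ.trans hη) (abs_nonneg _) (abs_edgeWeight_le hw o)
    have h2 := (abs_le.1 (Real.abs_exp_sub_one_sub_id_le h1)).2
    rw [mul_pow] at h2
    linarith
  have hθ2 : θ ^ 2 ≤ η ^ 2 := sq_le_sq' (abs_le.1 hθ).1 (abs_le.1 hθ).2
  have hv := sum_pairFactor_mul_edgeWeight_sq_le (w := w) hp0 hq0 hμ hν s t
  have hv0 : 0 ≤ ∑ o, pairFactor p q μ ν s t o * edgeWeight w o ^ 2 :=
    Finset.sum_nonneg fun o _ =>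
      mul_nonneg (pairFactor_nonneg hp0 hp1 hq0 hq1 hμ hν s t o) (sq_nonneg _)
  have h1 : ∑ o, pairFactor p q μ ν s t o * Real.exp (θ * edgeWeight w o)
      ≤ 1 + θ * m + θ ^ 2 * ∑ o, pairFactor p q μ ν s t o * edgeWeight w o ^ 2 := by
    calc _ ≤ ∑ o, pairFactor p q μ ν s t o
          * (1 + θ * edgeWeight w o + θ ^ 2 * edgeWeight w o ^ 2) :=
          Finset.sum_le_sum fun o _ => mul_le_mul_of_nonneg_left (hexp o)
            (pairFactor_nonneg hp0 hp1 hq0 hq1 hμ hν s t o)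
      _ = _ := by
        have h1 := sum_pairFactor (p := p) (q := q) hμ_sum hν_sum s t
        simp only [mul_add, mul_one, Finset.sum_add_distrib, h1, hm, Finset.mul_sum, mul_left_comm]
  have h2 : ∑ o, pairFactor p q μ ν s t o * Real.exp (θ * edgeWeight w o)
      ≤ Real.exp (θ * m + η ^ 2 * secondMoment p q μ ν w) := by
    have := Real.add_one_le_exp (θ * m + η ^ 2 * secondMoment p q μ ν w)
    have := mul_le_mul hθ2 hv hv0 (sq_nonneg η)
    linarith
  calc _ = Real.exp (-(θ * m)) * ∑ o, pairFactor p q μ ν s t o * Real.exp (θ * edgeWeight w o) := by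
        rw [Finset.mul_sum]
        refine Finset.sum_congr rfl fun o _ => ?_
        rw [mul_sub, sub_eq_add_neg, Real.exp_add]
        ring
    _ ≤ Real.exp (-(θ * m)) * Real.exp (θ * m + η ^ 2 * secondMoment p q μ ν w) := by gcongr
    _ = _ := by rw [← Real.exp_add]; congr 1; ring

open Classical in
/-- The conditional probability of an event given the types. -/
noncomputable def condProb (p q : ℝ) (μ ν : 𝓛 → ℝ) (σ : Fin n → ℤˣ)
    (A : Set (LabeledGraph n 𝓛)) : ℝ :=
  ∑ G, if G ∈ A then graphProb p q μ ν σ G else 0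

theorem sum_prod_labeledGraph (f : VertexPair n → Option 𝓛 → ℝ) :
    ∑ G : LabeledGraph n 𝓛, ∏ e, f e (G e) = ∏ e, ∑ o, f e o := by
  classical
  rw [Finset.prod_univ_sum, Fintype.piFinset_univ]

theorem sum_graphProb (hμ_sum : ∑ ℓ, μ ℓ = 1) (hν_sum : ∑ ℓ, ν ℓ = 1) (σ : Fin n → ℤˣ) :
    ∑ G, graphProb p q μ ν σ G = 1 := by
  unfold graphProb
  rw [sum_prod_labeledGraph fun e o => pairFactor p q μ ν (σ e.1.1) (σ e.1.2) o]
  simp [sum_pairFactor hμ_sum hν_sum]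

theorem prob_eq_signAvg (E : Set (Realization n 𝓛)) :
    prob p q μ ν E = signAvg fun σ => condProb p q μ ν σ {G | (G, σ) ∈ E} := by
  unfold prob signAvg condProb
  rw [Fintype.sum_prod_type_right, Finset.mul_sum]
  refine Finset.sum_congr rfl fun σ _ => ?_
  rw [Finset.mul_sum]
  refine Finset.sum_congr rfl fun G _ => ?_
  simp only [realizationProb, graphProb, mul_ite, mul_zero]
  by_cases h : (G, σ) ∈ E
  · rw [if_pos h, if_pos (show G ∈ {G | (G, σ) ∈ E} from h)]
  · rw [if_neg h, if_neg (show G ∉ {G | (G, σ) ∈ E} from h)]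

theorem prob_le_one (hp0 : 0 ≤ p) (hp1 : p ≤ 1) (hq0 : 0 ≤ q) (hq1 : q ≤ 1)
    (hμ : ∀ ℓ, 0 ≤ μ ℓ) (hν : ∀ ℓ, 0 ≤ ν ℓ) (hμ_sum : ∑ ℓ, μ ℓ = 1) (hν_sum : ∑ ℓ, ν ℓ = 1)
    (E : Set (Realization n 𝓛)) : prob p q μ ν E ≤ 1 := by
  rw [prob_eq_signAvg]
  refine (signAvg_mono fun σ => ?_).trans_eq (signAvg_const 1)
  rw [← sum_graphProb (p := p) (q := q) hμ_sum hν_sum σ]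
  refine Finset.sum_le_sum fun G _ => ?_
  have := graphProb_nonneg hp0 hp1 hq0 hq1 hμ hν σ G
  split_ifs <;> linarith

/-- Chernoff bound for a linear statistic of the centered weights given the types. -/
theorem condProb_lt_sum_le (hp0 : 0 ≤ p) (hp1 : p ≤ 1) (hq0 : 0 ≤ q) (hq1 : q ≤ 1)
    (hμ : ∀ ℓ, 0 ≤ μ ℓ) (hν : ∀ ℓ, 0 ≤ ν ℓ) (hμ_sum : ∑ ℓ, μ ℓ = 1) (hν_sum : ∑ ℓ, ν ℓ = 1)
    (hw : ∀ ℓ, w ℓ ∈ Set.Icc (-1 : ℝ) 1) (σ : Fin n → ℤˣ) {m c : VertexPair n → ℝ} {r t : ℝ}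
    (hm : ∀ e, m e = ∑ o, pairFactor p q μ ν (σ e.1.1) (σ e.1.2) o * edgeWeight w o)
    (hc : ∀ e, |c e| ≤ 2) (hr0 : 0 ≤ r) (hr : 2 * r ≤ 1) :
    condProb p q μ ν σ {G | t < ∑ e, c e * (edgeWeight w (G e) - m e)}
      ≤ Real.exp (-(r * t) + 2 * r ^ 2 * secondMoment p q μ ν w * n ^ 2) := by
  have hs : 0 ≤ secondMoment p q μ ν w := Finset.sum_nonneg fun ℓ _ =>
    mul_nonneg (add_nonneg (mul_nonneg hp0 (hμ ℓ)) (mul_nonneg hq0 (hν ℓ))) (sq_nonneg _)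
  calc condProb p q μ ν σ {G | t < ∑ e, c e * (edgeWeight w (G e) - m e)}
      ≤ ∑ G : LabeledGraph n 𝓛, Real.exp (-(r * t)) * ∏ e : VertexPair n,
          (pairFactor p q μ ν (σ e.1.1) (σ e.1.2) (G e)
            * Real.exp (r * c e * (edgeWeight w (G e) - m e))) := by
        refine Finset.sum_le_sum fun G _ => ?_
        have hG := graphProb_nonneg hp0 hp1 hq0 hq1 hμ hν σ G
        -- Markov's inequality: the indicator of the event is at most exp(r(Σ - t)), whose mean
        -- factorizes over the pairs.
        rw [Finset.prod_mul_distrib, ← Real.exp_sum, mul_left_comm, ← Real.exp_add]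
        split_ifs with h
        · refine le_mul_of_one_le_right hG (Real.one_le_exp ?_)
          have := mul_le_mul_of_nonneg_left (le_of_lt h) hr0
          simp only [mul_assoc, ← Finset.mul_sum] at this ⊢
          linarith
        · exact mul_nonneg hG (Real.exp_pos _).le
    _ = Real.exp (-(r * t)) * ∏ e : VertexPair n, ∑ o,
          pairFactor p q μ ν (σ e.1.1) (σ e.1.2) o
            * Real.exp (r * c e * (edgeWeight w o - m e)) := by
        rw [← Finset.mul_sum, sum_prod_labeledGraph fun e o =>
          pairFactor p q μ ν (σ e.1.1) (σ e.1.2) o * Real.exp (r * c e * (edgeWeight w o - m e))]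
    _ ≤ Real.exp (-(r * t)) * ∏ _e : VertexPair n,
          Real.exp ((2 * r) ^ 2 * secondMoment p q μ ν w) := by
        gcongr with e
        · exact fun e _ => Finset.sum_nonneg fun o _ =>
            mul_nonneg (pairFactor_nonneg hp0 hp1 hq0 hq1 hμ hν _ _ _) (Real.exp_pos _).le
        · refine sum_pairFactor_mul_exp_le hp0 hp1 hq0 hq1 hμ hν hμ_sum hν_sum hw _ _ (hm e) ?_ hr
          rw [abs_mul, abs_of_nonneg hr0]
          nlinarith [hc e]
    _ ≤ _ := by
        rw [Finset.prod_const, Finset.card_univ, ← Real.exp_nat_mul, ← Real.exp_add]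
        refine Real.exp_le_exp.2 ?_
        -- At most n²/2 pairs, each contributing (2r)² times the second moment.
        have := mul_le_mul_of_nonneg_right (card_vertexPair_le n)
          (by positivity : 0 ≤ (2 * r) ^ 2 * secondMoment p q μ ν w)
        nlinarith

/-- Concentration of the weighted adjacency matrix in cut norm given the types. -/
theorem condProb_cutNorm_gt_le {a b : ℝ} (hn : 0 < n) (ha : 0 ≤ a) (hb : 0 ≤ b) (han : a ≤ n)
    (hbn : b ≤ n)
    (hμ : ∀ ℓ, 0 ≤ μ ℓ) (hν : ∀ ℓ, 0 ≤ ν ℓ) (hμ_sum : ∑ ℓ, μ ℓ = 1) (hν_sum : ∑ ℓ, ν ℓ = 1)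
    (hw : ∀ ℓ, w ℓ ∈ Set.Icc (-1 : ℝ) 1) (hs : 8 * Real.log 2 < secondMoment a b μ ν w)
    (σ : Fin n → ℤˣ) :
    condProb (a / n) (b / n) μ ν σ {G | ∃ x z : Fin n → ℤˣ,
      5 * √(secondMoment a b μ ν w * Real.log 2) * n < ∑ u, ∑ v, (weightMatrix w G u v
        - meanMatrix (∑ ℓ, a * μ ℓ * w ℓ) (∑ ℓ, b * ν ℓ * w ℓ) σ u v)
          * ((x u : ℤ) : ℝ) * ((z v : ℤ) : ℝ)} ≤ (1 / 2) ^ n := by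
  classical
  set s := secondMoment a b μ ν w with hsdef
  set L := Real.log 2
  have hL : 0 < L := Real.log_pos (by norm_num)
  have hs0 : 0 < s := by linarith
  have hn' : (0 : ℝ) < n := Nat.cast_pos.2 hn
  have hp0 : 0 ≤ a / n := by positivity
  have hq0 : 0 ≤ b / n := by positivity
  have hp1 : a / n ≤ 1 := (div_le_one hn').2 han
  have hq1 : b / n ≤ 1 := (div_le_one hn').2 hbn
  have hsn : secondMoment (a / n) (b / n) μ ν w = s / n := by
    rw [hsdef, secondMoment, secondMoment, Finset.sum_div]
    exact Finset.sum_congr rfl fun ℓ _ => by field_simp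
  set T := 5 * √(s * L) * n with hT
  -- With this `r` the Chernoff exponent is -5Ln + 2Ln = -3Ln, that is 8⁻ⁿ, which beats the 4ⁿ pairs
  -- of sign vectors. The lower bound on `s` ensures 2r ≤ 1.
  set r := √(L / s) with hr
  have hr2 : r ^ 2 = L / s := Real.sq_sqrt (by positivity)
  have hr0 : 0 ≤ r := Real.sqrt_nonneg _
  have hr1 : 2 * r ≤ 1 := by
    have : r ^ 2 ≤ (1 / 2) ^ 2 := by
      rw [hr2, div_le_iff₀ hs0]; linarith
    have := abs_le_of_sq_le_sq' this (by norm_num)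
    linarith [this.2]
  have hrT : r * T = 5 * L * n := by
    have : r * √(s * L) = L := by
      rw [hr, ← Real.sqrt_mul (by positivity)]
      rw [show L / s * (s * L) = L * L by field_simp, Real.sqrt_mul_self hL.le]
    rw [hT]; linear_combination 5 * n * this
  have hone : ∀ x z : Fin n → ℤˣ, condProb (a / n) (b / n) μ ν σ {G |
      T < ∑ u, ∑ v, (weightMatrix w G u v
        - meanMatrix (∑ ℓ, a * μ ℓ * w ℓ) (∑ ℓ, b * ν ℓ * w ℓ) σ u v)
          * ((x u : ℤ) : ℝ) * ((z v : ℤ) : ℝ)} ≤ (1 / 8) ^ n := by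
    intro x z
    have habs : ∀ (y : Fin n → ℤˣ) u, |((y u : ℤ) : ℝ)| = 1 := fun y u => by
      rcases Int.units_eq_one_or (y u) with h | h <;> simp [h]
    have h := condProb_lt_sum_le (w := w) (t := T) (r := r)
      (c := fun e => ((x e.1.1 : ℤ) : ℝ) * ((z e.1.2 : ℤ) : ℝ)
        + ((x e.1.2 : ℤ) : ℝ) * ((z e.1.1 : ℤ) : ℝ))
      (m := fun e => meanMatrix (∑ ℓ, a * μ ℓ * w ℓ) (∑ ℓ, b * ν ℓ * w ℓ) σ e.1.1 e.1.2)
      hp0 hp1 hq0 hq1 hμ hν hμ_sum hν_sum hw σ ?_ ?_ hr0 hr1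
    · refine (le_of_eq ?_).trans (h.trans_eq ?_)
      · congr 1
        ext G
        exact iff_of_eq (congrArg (T < ·) (sum_weightMatrix_sub_mul σ G
          (fun u => ((x u : ℤ) : ℝ)) (fun u => ((z u : ℤ) : ℝ))))
      rw [hrT, hsn, hr2]
      rw [show -(5 * L * n) + 2 * (L / s) * (s / n) * (n : ℝ) ^ 2 = n * -(3 * L) by
        field_simp; ring, Real.exp_nat_mul, Real.exp_neg,
        show 3 * L = (3 : ℕ) * L by norm_num, Real.exp_nat_mul, Real.exp_log (by norm_num)]
      norm_num
    · intro e
      rw [sum_pairFactor_mul_edgeWeight]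
      simp only [meanMatrix, e.2.ne, if_false, Finset.sum_div]
      split_ifs <;> exact Finset.sum_congr rfl fun ℓ _ => by ring
    · intro e
      refine (abs_add_le _ _).trans ?_
      simp only [abs_mul, habs]
      norm_num
  calc _ ≤ ∑ x : Fin n → ℤˣ, ∑ z : Fin n → ℤˣ, condProb (a / n) (b / n) μ ν σ {G |
      T < ∑ u, ∑ v, (weightMatrix w G u v
        - meanMatrix (∑ ℓ, a * μ ℓ * w ℓ) (∑ ℓ, b * ν ℓ * w ℓ) σ u v)
          * ((x u : ℤ) : ℝ) * ((z v : ℤ) : ℝ)} := by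
        unfold condProb
        conv_rhs => enter [2, x]; rw [Finset.sum_comm]
        rw [Finset.sum_comm]
        refine Finset.sum_le_sum fun G _ => ?_
        have hG := graphProb_nonneg hp0 hp1 hq0 hq1 hμ hν σ G
        have hnn : ∀ x z : Fin n → ℤˣ, 0 ≤ if G ∈ {G | T < ∑ u, ∑ v, (weightMatrix w G u v
            - meanMatrix (∑ ℓ, a * μ ℓ * w ℓ) (∑ ℓ, b * ν ℓ * w ℓ) σ u v)
            * ((x u : ℤ) : ℝ) * ((z v : ℤ) : ℝ)} then graphProb (a / n) (b / n) μ ν σ G else 0 :=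
          fun x z => by split_ifs <;> first | exact hG | exact le_rfl
        split_ifs with h
        · obtain ⟨x, z, hxz⟩ := h
          refine le_trans ?_ (Finset.single_le_sum
            (fun x _ => Finset.sum_nonneg fun z _ => hnn x z) (Finset.mem_univ x))
          refine le_trans ?_ (Finset.single_le_sum (fun z _ => hnn x z) (Finset.mem_univ z))
          rw [if_pos]
          exact hxz
        · exact Finset.sum_nonneg fun x _ => Finset.sum_nonneg fun z _ => hnn x z
    _ ≤ ∑ _x : Fin n → ℤˣ, ∑ _z : Fin n → ℤˣ, (1 / 8 : ℝ) ^ n :=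
        Finset.sum_le_sum fun x _ => Finset.sum_le_sum fun z _ => hone x z
    _ = (1 / 2) ^ n := by
        simp
        rw [← inv_pow, ← mul_pow, ← mul_pow, ← inv_pow]
        norm_num

end model

/-! ### Reconstruction and the optimal weight. -/

section reconstruction
variable {𝓛 : Type*} {a b : ℝ} {μ ν : 𝓛 → ℝ}

theorem optWeight_mem_Icc (ha : 0 ≤ a) (hb : 0 ≤ b) (hμ : ∀ ℓ, 0 ≤ μ ℓ) (hν : ∀ ℓ, 0 ≤ ν ℓ)
    (ℓ : 𝓛) : optWeight a b μ ν ℓ ∈ Set.Icc (-1 : ℝ) 1 := by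
  have h1 := mul_nonneg ha (hμ ℓ)
  have h2 := mul_nonneg hb (hν ℓ)
  unfold optWeight
  rcases (add_nonneg h1 h2).eq_or_lt with h | h
  · rw [← h]; norm_num
  · constructor
    · rw [le_div_iff₀ h]; linarith
    · rw [div_le_one h]; linarith

theorem sub_eq_add_mul_optWeight (ha : 0 ≤ a) (hb : 0 ≤ b) (hμ : ∀ ℓ, 0 ≤ μ ℓ)
    (hν : ∀ ℓ, 0 ≤ ν ℓ) (ℓ : 𝓛) :
    a * μ ℓ - b * ν ℓ = (a * μ ℓ + b * ν ℓ) * optWeight a b μ ν ℓ := by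
  have h1 := mul_nonneg ha (hμ ℓ)
  have h2 := mul_nonneg hb (hν ℓ)
  unfold optWeight
  rcases (add_nonneg h1 h2).eq_or_lt with h | h
  · rw [← h]; linarith
  · rw [mul_div_cancel₀ _ h.ne']

variable [Fintype 𝓛]

theorem prob_overlap_ge {n : ℕ} {w : 𝓛 → ℝ} (hn : 3 ≤ n) (ha : 0 ≤ a) (hb : 0 ≤ b) (han : a ≤ n)
    (hbn : b ≤ n)
    (hμ : ∀ ℓ, 0 ≤ μ ℓ) (hν : ∀ ℓ, 0 ≤ ν ℓ) (hμ_sum : ∑ ℓ, μ ℓ = 1) (hν_sum : ∑ ℓ, ν ℓ = 1)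
    (hw : ∀ ℓ, w ℓ ∈ Set.Icc (-1 : ℝ) 1) (hs : 8 * Real.log 2 < secondMoment a b μ ν w)
    (hgap : 512 * √(Real.log 2) < normalizedGap a b μ ν w) :
    1 - (1 / 2) ^ n - 2500 / n ≤ prob (a / n) (b / n) μ ν
      {x : Realization n 𝓛 | ∀ (Y : Matrix (Fin n) (Fin n) ℝ) (y : Fin n → ℝ),
        IsSDPSolution (weightMatrix w x.1) Y → IsTopEigenvector Y y →
          1 / 10 ≤ overlap (typeVec x.2) (fun u => Real.sign (y u))} := by
  classical
  have hn0 : 0 < n := by omega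
  have hn' : (0 : ℝ) < n := Nat.cast_pos.2 hn0
  have hL : 0 < Real.log 2 := Real.log_pos (by norm_num)
  set s := secondMoment a b μ ν w with hsdef
  set α := ∑ ℓ, a * μ ℓ * w ℓ with hα
  set β := ∑ ℓ, b * ν ℓ * w ℓ with hβ
  have hs0 : 0 < s := by linarith
  -- The form in which the gap meets `hBg` of `overlap_ge_of_cutNorm_le` with B = 5√(s ln 2)·n.
  have hg : 512 * √(s * Real.log 2) < α - β := by
    rw [normalizedGap, ← hsdef, lt_div_iff₀ (Real.sqrt_pos.2 hs0)] at hgap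
    have e : ∑ ℓ, (a * μ ℓ - b * ν ℓ) * w ℓ = α - β := by
      simp only [sub_mul, Finset.sum_sub_distrib, hα, hβ]
    rw [Real.sqrt_mul hs0.le]
    linarith
  have hg0 : 0 < α - β := lt_of_le_of_lt (by positivity) hg
  set E : Set (Realization n 𝓛) := {x | ∀ (Y : Matrix (Fin n) (Fin n) ℝ) (y : Fin n → ℝ),
    IsSDPSolution (weightMatrix w x.1) Y → IsTopEigenvector Y y →
      1 / 10 ≤ overlap (typeVec x.2) (fun u => Real.sign (y u))} with hE
  have hG := graphProb_nonneg (n := n) (div_nonneg ha hn'.le) ((div_le_one hn').2 han)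
    (div_nonneg hb hn'.le) ((div_le_one hn').2 hbn) hμ hν
  -- Chebyshev built into a pointwise bound: for |Σσ| > n/50 the left side is negative since 2500 =
  -- 50². Averaging over σ, with mean square n for Σσ, yields the loss 2500/n.
  have hcond : ∀ σ : Fin n → ℤˣ, 1 - (1 / 2) ^ n + -(2500 / n ^ 2) * signSum (fun _ => 1) σ ^ 2
      ≤ condProb (a / n) (b / n) μ ν σ {G | (G, σ) ∈ E} := by
    intro σ
    have hsig : signSum (fun _ => 1) σ = ∑ u, typeVec σ u := by simp [signSum, typeVec]
    rw [hsig]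
    have hnn : 0 ≤ condProb (a / n) (b / n) μ ν σ {G | (G, σ) ∈ E} :=
      Finset.sum_nonneg fun G _ => by
        split_ifs
        · exact hG σ G
        · exact le_rfl
    by_cases hbal : |∑ u, typeVec σ u| ≤ n / 50
    · have h1 := condProb_cutNorm_gt_le hn0 ha hb han hbn hμ hν hμ_sum hν_sum hw hs σ
      have h2 : (1 : ℝ) ≤ condProb (a / n) (b / n) μ ν σ {G | (G, σ) ∈ E}
          + condProb (a / n) (b / n) μ ν σ {G | ∃ x z : Fin n → ℤˣ,
            5 * √(s * Real.log 2) * n < ∑ u, ∑ v, (weightMatrix w G u v - meanMatrix α β σ u v)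
              * ((x u : ℤ) : ℝ) * ((z v : ℤ) : ℝ)} := by
        rw [← sum_graphProb (p := a / n) (q := b / n) hμ_sum hν_sum σ, condProb, condProb,
          ← Finset.sum_add_distrib]
        refine Finset.sum_le_sum fun G _ => ?_
        have hGσ := hG σ G
        by_cases hbad : ∃ x z : Fin n → ℤˣ,
            5 * √(s * Real.log 2) * n < ∑ u, ∑ v, (weightMatrix w G u v - meanMatrix α β σ u v)
              * ((x u : ℤ) : ℝ) * ((z v : ℤ) : ℝ)
        · split_ifs with h1 h2 h2
          · linarith
          · exact absurd hbad h2
          · linarith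
          · exact absurd hbad h2
        · have hmem : G ∈ {G | (G, σ) ∈ E} := fun Y y hY hy =>
            overlap_ge_of_cutNorm_le hn σ hg0 hbal
              (by nlinarith : 512 * (5 * √(s * Real.log 2) * n) ≤ 5 * (α - β) * n)
              (fun x z => not_lt.1 fun h => hbad ⟨x, z, h⟩) hY hy
          rw [if_pos hmem]
          split_ifs <;> linarith
      have h3 : 0 ≤ 2500 / (n : ℝ) ^ 2 * (∑ u, typeVec σ u) ^ 2 := by positivity
      linarith
    · have h1 : (n / 50 : ℝ) ^ 2 ≤ (∑ u, typeVec σ u) ^ 2 := by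
        rw [← sq_abs (∑ u, typeVec σ u)]
        exact pow_le_pow_left₀ (by positivity) (not_le.1 hbal).le 2
      have h2 : 1 ≤ 2500 / (n : ℝ) ^ 2 * (∑ u, typeVec σ u) ^ 2 := by
        calc (1 : ℝ) = 2500 / (n : ℝ) ^ 2 * (n / 50) ^ 2 := by field_simp; norm_num
          _ ≤ _ := by gcongr
      have h3 : (0 : ℝ) ≤ (1 / 2) ^ n := by positivity
      linarith
  rw [prob_eq_signAvg]
  refine le_trans (le_of_eq ?_) (signAvg_mono hcond)
  rw [signAvg_add, signAvg_mul_left, signAvg_const, signAvg_signSum_sq]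
  simp
  field_simp
  ring

theorem sdpPositivelyCorrelated_of_normalizedGap_gt {w : 𝓛 → ℝ} (ha : 0 ≤ a) (hb : 0 ≤ b)
    (hμ : ∀ ℓ, 0 ≤ μ ℓ) (hν : ∀ ℓ, 0 ≤ ν ℓ) (hμ_sum : ∑ ℓ, μ ℓ = 1) (hν_sum : ∑ ℓ, ν ℓ = 1)
    (hw : ∀ ℓ, w ℓ ∈ Set.Icc (-1 : ℝ) 1) (hs : 8 * Real.log 2 < secondMoment a b μ ν w)
    (hgap : 512 * √(Real.log 2) < normalizedGap a b μ ν w) :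
    SDPPositivelyCorrelated a b μ ν w := by
  refine ⟨1 / 10, by norm_num, ?_⟩
  have hlim : Filter.Tendsto (fun n : ℕ => 1 - (1 / 2 : ℝ) ^ n - 2500 / n) Filter.atTop
      (nhds 1) := by
    have h1 := tendsto_pow_atTop_nhds_zero_of_lt_one (r := (1 / 2 : ℝ)) (by norm_num) (by norm_num)
    have h2 := tendsto_const_div_atTop_nhds_zero_nat (2500 : ℝ)
    simpa using (h1.const_sub 1).sub h2
  have hev : ∀ᶠ n : ℕ in Filter.atTop, 3 ≤ n ∧ a ≤ n ∧ b ≤ n :=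
    (Filter.eventually_ge_atTop 3).and
      ((tendsto_natCast_atTop_atTop.eventually_ge_atTop a).and
        (tendsto_natCast_atTop_atTop.eventually_ge_atTop b))
  refine tendsto_of_tendsto_of_tendsto_of_le_of_le' hlim tendsto_const_nhds ?_ ?_
  · filter_upwards [hev] with n ⟨hn, han, hbn⟩
    exact prob_overlap_ge hn ha hb han hbn hμ hν hμ_sum hν_sum hw hs hgap
  · filter_upwards [hev] with n ⟨hn, han, hbn⟩
    have hn' : (0 : ℝ) < n := by exact_mod_cast (by omega : 0 < n)
    exact prob_le_one (div_nonneg ha hn'.le) ((div_le_one hn').2 han) (div_nonneg hb hn'.le)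
      ((div_le_one hn').2 hbn) hμ hν hμ_sum hν_sum _

theorem normalizedGap_optWeight (ha : 0 ≤ a) (hb : 0 ≤ b) (hμ : ∀ ℓ, 0 ≤ μ ℓ)
    (hν : ∀ ℓ, 0 ≤ ν ℓ) :
    normalizedGap a b μ ν (optWeight a b μ ν) = √(secondMoment a b μ ν (optWeight a b μ ν)) := by
  have e : ∑ ℓ, (a * μ ℓ - b * ν ℓ) * optWeight a b μ ν ℓ
      = secondMoment a b μ ν (optWeight a b μ ν) :=
    Finset.sum_congr rfl fun ℓ _ => by rw [sub_eq_add_mul_optWeight ha hb hμ hν]; ring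
  rw [normalizedGap, e, Real.div_sqrt]

/-- The numerator is the inner product of `w` and `optWeight` with weights aμ + bν, so
Cauchy–Schwarz applies. -/
theorem normalizedGap_le (ha : 0 ≤ a) (hb : 0 ≤ b) (hμ : ∀ ℓ, 0 ≤ μ ℓ) (hν : ∀ ℓ, 0 ≤ ν ℓ)
    (w : 𝓛 → ℝ) :
    normalizedGap a b μ ν w ≤ normalizedGap a b μ ν (optWeight a b μ ν) := by
  rw [normalizedGap_optWeight ha hb hμ hν]
  have hc : ∀ ℓ, 0 ≤ a * μ ℓ + b * ν ℓ := fun ℓ =>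
    add_nonneg (mul_nonneg ha (hμ ℓ)) (mul_nonneg hb (hν ℓ))
  -- This form of the division bound also covers a vanishing denominator, where R(w) = 0.
  refine div_le_of_le_mul₀ (Real.sqrt_nonneg _) (Real.sqrt_nonneg _) ?_
  rw [secondMoment, secondMoment, ← Real.sqrt_mul (Finset.sum_nonneg fun ℓ _ => mul_nonneg (hc ℓ) (sq_nonneg _))]
  refine Real.le_sqrt_of_sq_le ?_
  have h := Finset.sum_mul_sq_le_sq_mul_sq Finset.univ
    (fun ℓ => √(a * μ ℓ + b * ν ℓ) * optWeight a b μ ν ℓ) (fun ℓ => √(a * μ ℓ + b * ν ℓ) * w ℓ)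
  simp only [mul_pow, Real.sq_sqrt (hc _)] at h
  refine le_of_eq_of_le (congrArg (· ^ 2) (Finset.sum_congr rfl fun ℓ _ => ?_)) h
  rw [sub_eq_add_mul_optWeight ha hb hμ hν]
  linear_combination -(optWeight a b μ ν ℓ * w ℓ) * Real.mul_self_sqrt (hc ℓ)

theorem tau_eq (ha : 0 ≤ a) (hb : 0 ≤ b) :
    tau a b μ ν = secondMoment a b μ ν (optWeight a b μ ν) / 2 := by
  unfold tau secondMoment optWeight
  rcases (add_nonneg ha hb).eq_or_lt with h | h
  · have ha0 : a = 0 := by linarith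
    have hb0 : b = 0 := by linarith
    simp [ha0, hb0]
  · rw [Finset.mul_sum, Finset.sum_div]
    refine Finset.sum_congr rfl fun ℓ _ => ?_
    have := h.ne'
    -- The ratio is kept opaque because its denominator may vanish; only a + b has to be cancelled.
    generalize (a * μ ℓ - b * ν ℓ) / (a * μ ℓ + b * ν ℓ) = x
    field_simp

/-- R(w*)² = 2τ and 512² = 2¹⁸. -/
theorem normalizedGap_optWeight_gt_iff (ha : 0 ≤ a) (hb : 0 ≤ b) (hμ : ∀ ℓ, 0 ≤ μ ℓ)
    (hν : ∀ ℓ, 0 ≤ ν ℓ) :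
    512 * √(Real.log 2) < normalizedGap a b μ ν (optWeight a b μ ν) ↔
      2 ^ 17 * Real.log 2 < tau a b μ ν := by
  have hL : 0 < Real.log 2 := Real.log_pos (by norm_num)
  rw [normalizedGap_optWeight ha hb hμ hν, tau_eq ha hb, Real.lt_sqrt (by positivity), mul_pow,
    Real.sq_sqrt hL.le]
  constructor <;> intro h <;> linarith

end reconstruction

end LabeledSBM

theorem mainTheorem4 {𝓛 : Type*} [Fintype 𝓛] (a b : ℝ) (ha : 0 ≤ a) (hb : 0 ≤ b)
    (μ ν : 𝓛 → ℝ) (hμ : ∀ ℓ, 0 ≤ μ ℓ) (hμ_sum : ∑ ℓ, μ ℓ = 1)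
    (hν : ∀ ℓ, 0 ≤ ν ℓ) (hν_sum : ∑ ℓ, ν ℓ = 1) :
    (∀ w : 𝓛 → ℝ, (∀ ℓ, w ℓ ∈ Set.Icc (-1 : ℝ) 1) →
      LabeledSBM.secondMoment a b μ ν w > 8 * Real.log 2 →
      LabeledSBM.normalizedGap a b μ ν w > 512 * √(Real.log 2) →
      LabeledSBM.SDPPositivelyCorrelated a b μ ν w) ∧
    (∀ ℓ, LabeledSBM.optWeight a b μ ν ℓ ∈ Set.Icc (-1 : ℝ) 1) ∧
    (∀ w : 𝓛 → ℝ, LabeledSBM.normalizedGap a b μ ν w ≤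
      LabeledSBM.normalizedGap a b μ ν (LabeledSBM.optWeight a b μ ν)) ∧
    (LabeledSBM.normalizedGap a b μ ν (LabeledSBM.optWeight a b μ ν) > 512 * √(Real.log 2) ↔
      LabeledSBM.tau a b μ ν > 2 ^ 17 * Real.log 2) := by
  exact ⟨fun _ hw hs hgap => LabeledSBM.sdpPositivelyCorrelated_of_normalizedGap_gt ha hb hμ hν
      hμ_sum hν_sum hw hs hgap,
    LabeledSBM.optWeight_mem_Icc ha hb hμ hν, LabeledSBM.normalizedGap_le ha hb hμ hν,
    LabeledSBM.normalizedGap_optWeight_gt_iff ha hb hμ hν⟩
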